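/- Let $d\ge 2$, $G=\mathrm{SL}(d,\mathbb R)$, $\Gamma=\mathrm{SL}(d,\mathbb Z)$, and let $\mathcal F\subset G$ be a fundamental domain of $\Gamma\backslash G$, i.e. a set that meets every orbit $\Gamma M$ in exactly one point, which is contained in some Siegel set: there are constants $c,C$ such that every $M\in\mathcal F$ is of the form $M=n\,a\,k$ with $n$ upper triangular unipotent with off-diagonal entries bounded by $C$ in absolute value, $a=\mathrm{diag}(a_1,\dots,a_d)$ with $a_j>0$ and $a_{j+1}\le c\,a_j$, and $k$ orthogonal. Let $\|\cdot\|$ be the $\ell^1$-norm on $\mathbb R^d$ and the corresponding operator norm on matrices. For $\omega=(\alpha,1)$ with $\alpha\in\mathbb R^{d-1}$, let $M_\omega=\begin{pmatrix}I&\alpha\\0&1\end{pmatrix}$, $E^t=\mathrm{diag}(e^{-t},\dots,e^{-t},e^{(d-1)t})$, and let $P(t)\in\Gamma$ be the unique matrix with $P(t)M_\omega E^t\in\mathcal F$. Stopping times are sequences $0=t_0<t_1<t_2<\cdots\to+\infty$ such that the matrices $P_0=I$, $P_n=P(t_n)$ $(n\ge1)$ satisfy $P_n\ne P_{n-1}$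 for all $n\ge1$; put $T_0=I$ and $T_n=P_nP_{n-1}^{-1}$ for $n\ge1$. Let $\gamma_n$ be the $d$-th component of $e^{(d-1)t_n}P_n\omega$ and, if $\gamma_n\neq0$ for all $n$, let $\lambda_n=e^{(d-1)t_n}/\gamma_n$, $\eta_n=\lambda_n/\lambda_{n-1}$ $(n\ge 1)$ and $\omega_n=\lambda_nP_n\omega$. Resonance widths are (strictly) decreasing sequences $(\sigma_n)_{n\ge0}$ of positive numbers; for these let $$I_n^+=\{k\in\mathbb Z^d:\ |k\cdot\omega_n|\le\sigma_n\|k\|\},\qquad A_n=\sup_{k\in I_n^+\setminus\{0\}}\frac{\|{}^{\top}T_{n+1}^{-1}k\|}{\|k\|}.$$ The vector $\omega=(\alpha,1)$ belongs to $\mathcal Y$ if there are resonance widths $\sigma$ and stopping times $t$ such that $\gamma_n\ne0$ for all $n$, the series $$\sum_{n\ge0}A_0\cdots A_n\,\log\left(|\eta_{n+1}|\,\|T_{n+1}\|\,\frac{\sigma_n\|\omega_{n+1}\|}{\sigma_{n+1}}\right)$$ converges absolutely, and $$\lim_{n\to+\infty}2^{2n}\sigma_n\|P_n^{-1}\|\,\|T_0\|^2\cdots\|T_n\|^2=0.$$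 A general $\omega\in\mathbb R^d$ belongs to $\mathcal Y$ if its last coordinate $\omega_d$ is nonzero and $\omega/\omega_d=(\alpha,1)$ belongs to $\mathcal Y$. A vector $\omega\in\mathbb R^d$ is diophantine if there are $\beta\ge0$ and $C>0$ with $|\omega\cdot k|>C\,\|k\|^{-(d-1+\beta)}$ for all $k\in\mathbb Z^d\setminus\{0\}$. Proposition. Every diophantine vector of $\mathbb R^d$ belongs to $\mathcal Y$. Moreover $\mathcal Y$ has full Lebesgue measure: almost every $\omega\in\mathbb R^d$ belongs to $\mathcal Y$, and for almost every $\alpha\in\mathbb R^{d-1}$ the vector $(\alpha,1)$ belongs to $\mathcal Y$. -/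

import Mathlib

open Filter Topology MeasureTheory

namespace TorusCF

/-- The `ℓ¹`-norm of a vector. -/
noncomputable def l1Norm {ι : Type*} [Fintype ι] (v : ι → ℝ) : ℝ := ∑ i, |v i|

/-- The norm of a real square matrix as a linear operator of `ℝᵈ` with the `ℓ¹`-norm. -/
noncomputable def opNorm {ι : Type*} [Fintype ι] [DecidableEq ι] (A : Matrix ι ι ℝ) : ℝ :=
  ‖LinearMap.toContinuousLinearMap (Matrix.toLpLin 1 1 A)‖

theorem l1Norm_eq_norm {ι : Type*} [Fintype ι] (v : ι → ℝ) :
    l1Norm v = ‖WithLp.toLp 1 v‖ := by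
  simp [l1Norm, PiLp.norm_eq_of_L1]

theorem l1Norm_mulVec_le {ι : Type*} [Fintype ι] [DecidableEq ι] (A : Matrix ι ι ℝ)
    (v : ι → ℝ) : l1Norm (A.mulVec v) ≤ opNorm A * l1Norm v := by
  rw [l1Norm_eq_norm, l1Norm_eq_norm]
  exact (LinearMap.toContinuousLinearMap (Matrix.toLpLin 1 1 A)).le_opNorm (WithLp.toLp 1 v)

/-! Throughout, the dimension is `d = m + 1`; the `d`-th coordinate is `Fin.last m`. -/

/-- `G = SL(d, ℝ)`. -/
abbrev G (m : ℕ) : Type := Matrix.SpecialLinearGroup (Fin (m + 1)) ℝ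

/-- `Γ = SL(d, ℤ)`. -/
abbrev Gam (m : ℕ) : Type := Matrix.SpecialLinearGroup (Fin (m + 1)) ℤ

/-- The inclusion of `Γ` in `G`. -/
noncomputable def toG {m : ℕ} (P : Gam m) : G m :=
  Matrix.SpecialLinearGroup.map (Int.castRingHom ℝ) P

/-- A matrix of `Γ`, as a real matrix. -/
noncomputable def toMat {m : ℕ} (P : Gam m) : Matrix (Fin (m + 1)) (Fin (m + 1)) ℝ :=
  (toG P).1

/-- An (exact) fundamental domain of `Γ \ G`: it meets every orbit `Γ M` in exactly one point
(the left action of `Γ` on `G` is free, so that the matrix of `Γ` is unique too). -/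
def IsFundDomain {m : ℕ} (F : Set (G m)) : Prop :=
  ∀ M : G m, ∃! P : Gam m, toG P * M ∈ F

/-- The Siegel set with parameters `c`, `C`: the matrices `n a k` with `n` unipotent upper
triangular with entries bounded by `C`, with `a` diagonal and positive, `a_{j+1} ≤ c a_j`,
and with `k` orthogonal. -/
def siegelSet (m : ℕ) (c C : ℝ) : Set (G m) :=
  {M | ∃ (n : Matrix (Fin (m + 1)) (Fin (m + 1)) ℝ) (a : Fin (m + 1) → ℝ)
      (k : Matrix (Fin (m + 1)) (Fin (m + 1)) ℝ),
      (∀ i, n i i = 1) ∧ (∀ i j, j < i → n i j = 0) ∧ (∀ i j, i < j → |n i j| ≤ C) ∧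
      (∀ i, 0 < a i) ∧ (∀ j : Fin m, a j.succ ≤ c * a j.castSucc) ∧
      k ∈ Matrix.orthogonalGroup (Fin (m + 1)) ℝ ∧
      M.1 = n * Matrix.diagonal a * k}

/-- The vector `(α, 1)`. -/
def vec {m : ℕ} (α : Fin m → ℝ) : Fin (m + 1) → ℝ := Fin.snoc α 1

@[simp] theorem vec_last {m : ℕ} (α : Fin m → ℝ) : vec α (Fin.last m) = 1 := by
  simp [vec]

@[simp] theorem vec_castSucc {m : ℕ} (α : Fin m → ℝ) (i : Fin m) :
    vec α i.castSucc = α i := by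
  simp [vec]

/-- The matrix `M_ω` for `ω = (α, 1)`: the identity with last column `ω`. -/
def startMatrix {m : ℕ} (α : Fin m → ℝ) : G m :=
  ⟨(1 : Matrix (Fin (m + 1)) (Fin (m + 1)) ℝ).updateCol (Fin.last m) (vec α), by
    rw [Matrix.det_of_isUpperTriangular]
    · refine Finset.prod_eq_one fun i _ => ?_
      rw [Matrix.updateCol_apply]
      split_ifs with h
      · rw [h, vec_last]
      · exact Matrix.one_apply_eq i
    · intro i j hij
      have hij' : j < i := hij
      rw [Matrix.updateCol_apply, if_neg (ne_of_lt (lt_of_lt_of_le hij' (Fin.le_last i)))]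
      exact Matrix.one_apply_ne (ne_of_gt hij')⟩

/-- `E^t = diag(e^{-t}, …, e^{-t}, e^{(d-1)t})`. -/
noncomputable def expDiag (m : ℕ) (t : ℝ) : G m :=
  ⟨Matrix.diagonal (Fin.snoc (fun _ : Fin m => Real.exp (-t)) (Real.exp (m * t))), by
    rw [Matrix.det_diagonal, Fin.prod_univ_castSucc]
    simp only [Fin.snoc_castSucc, Fin.snoc_last, Finset.prod_const, Finset.card_univ,
      Fintype.card_fin]
    rw [← Real.exp_nat_mul, ← Real.exp_add]
    simp⟩

open Classical in
/-- `P(t)`: the matrix of `Γ` with `P(t) M_ω E^t ∈ F`, for `ω = (α, 1)`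
(the value `1` if there is none is never used for a fundamental domain `F`). -/
noncomputable def flowP {m : ℕ} (F : Set (G m)) (α : Fin m → ℝ) (t : ℝ) : Gam m :=
  if h : ∃ P : Gam m, toG P * (startMatrix α * expDiag m t) ∈ F then h.choose else 1

theorem flowP_mem {m : ℕ} {F : Set (G m)} (hF : IsFundDomain F) (α : Fin m → ℝ) (t : ℝ) :
    toG (flowP F α t) * (startMatrix α * expDiag m t) ∈ F := by
  have h : ∃ P : Gam m, toG P * (startMatrix α * expDiag m t) ∈ F := (hF _).exists
  rw [flowP, dif_pos h]
  exact h.choose_spec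

section Expansion

variable {m : ℕ} (F : Set (G m)) (α : Fin m → ℝ) (t : ℕ → ℝ)

/-- The continued fractions matrices `P_0 = I` and `P_n = P(t_n)` for `n ≥ 1`. -/
noncomputable def cfP : ℕ → Gam m
  | 0 => 1
  | n + 1 => flowP F α (t (n + 1))

/-- The transfer matrices `T_0 = I` and `T_n = P_n P_{n-1}⁻¹` for `n ≥ 1`. -/
noncomputable def cfT : ℕ → Gam m
  | 0 => 1
  | n + 1 => cfP F α t (n + 1) * (cfP F α t n)⁻¹

/-- A sequence of stopping times. -/
structure IsStoppingSeq : Prop where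
  zero : t 0 = 0
  strictMono : StrictMono t
  tendsto : Tendsto t atTop atTop
  ne : ∀ n, cfP F α t (n + 1) ≠ cfP F α t n

/-- `γ_n`: the `d`-th component of `e^{(d-1) t_n} P_n ω`. -/
noncomputable def cfGamma (n : ℕ) : ℝ :=
  Real.exp (m * t n) * (toMat (cfP F α t n)).mulVec (vec α) (Fin.last m)

/-- `λ_n = e^{(d-1) t_n} / γ_n`. -/
noncomputable def cfLambda (n : ℕ) : ℝ := Real.exp (m * t n) / cfGamma F α t n

/-- `η_n = λ_n / λ_{n-1}` (used for `n ≥ 1` only). -/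
noncomputable def cfEta (n : ℕ) : ℝ := cfLambda F α t n / cfLambda F α t (n - 1)

/-- `ω_n = λ_n P_n ω`. -/
noncomputable def cfOmega (n : ℕ) : Fin (m + 1) → ℝ :=
  cfLambda F α t n • (toMat (cfP F α t n)).mulVec (vec α)

theorem cfOmega_last {n : ℕ} (h : cfGamma F α t n ≠ 0) :
    cfOmega F α t n (Fin.last m) = 1 := by
  unfold cfGamma at h
  have h2 := right_ne_zero_of_mul h
  simp only [cfOmega, cfLambda, cfGamma, Pi.smul_apply, smul_eq_mul]
  field_simp

/-- The integer vector `k`, as a real vector. -/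
def intVec {ι : Type*} (k : ι → ℤ) : ι → ℝ := fun i => (k i : ℝ)

/-- The resonant cone `I_n⁺` for the resonance widths `σ`. -/
def resCone (σ : ℕ → ℝ) (n : ℕ) : Set (Fin (m + 1) → ℤ) :=
  {k | |dotProduct (intVec k) (cfOmega F α t n)| ≤ σ n * l1Norm (intVec k)}

/-- `A_n`: the supremum of `‖ᵗT_{n+1}⁻¹ k‖ / ‖k‖` over the nonzero `k` of `I_n⁺`. -/
noncomputable def resA (σ : ℕ → ℝ) (n : ℕ) : ℝ :=
  sSup {r | ∃ k ∈ resCone F α t σ n, k ≠ 0 ∧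
    r = l1Norm ((toMat (cfT F α t (n + 1))⁻¹).transpose.mulVec (intVec k)) /
      l1Norm (intVec k)}

/-- The set over which `A_n` is a supremum is bounded. -/
theorem bddAbove_resA (σ : ℕ → ℝ) (n : ℕ) :
    BddAbove {r | ∃ k ∈ resCone F α t σ n, k ≠ 0 ∧
      r = l1Norm ((toMat (cfT F α t (n + 1))⁻¹).transpose.mulVec (intVec k)) /
        l1Norm (intVec k)} := by
  refine ⟨opNorm (toMat (cfT F α t (n + 1))⁻¹).transpose, ?_⟩
  rintro r ⟨k, -, -, rfl⟩
  refine div_le_of_le_mul₀ ?_ (norm_nonneg _) (l1Norm_mulVec_le _ _)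
  exact Finset.sum_nonneg fun i _ => abs_nonneg _

/-- Resonance widths: a decreasing sequence of positive numbers. -/
structure IsResWidths (σ : ℕ → ℝ) : Prop where
  pos : ∀ n, 0 < σ n
  strictAnti : StrictAnti σ

end Expansion

/-- The vector `ω = (α, 1)` is of class `𝒴`. The condition `γ_n ≠ 0` says that the vectors `ω_n`
are defined. -/
def IsYVec {m : ℕ} (F : Set (G m)) (α : Fin m → ℝ) : Prop :=
  ∃ (σ : ℕ → ℝ) (t : ℕ → ℝ),
    IsResWidths σ ∧ IsStoppingSeq F α t ∧ (∀ n, cfGamma F α t n ≠ 0) ∧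
    Summable (fun n : ℕ => (∏ i ∈ Finset.range (n + 1), resA F α t σ i) *
      Real.log (|cfEta F α t (n + 1)| * opNorm (toMat (cfT F α t (n + 1))) *
        (σ n * l1Norm (cfOmega F α t (n + 1)) / σ (n + 1)))) ∧
    Tendsto (fun n : ℕ => 2 ^ (2 * n) * σ n * opNorm (toMat (cfP F α t n)⁻¹) *
      ∏ i ∈ Finset.range (n + 1), opNorm (toMat (cfT F α t i)) ^ 2) atTop (𝓝 0)

/-- The class `𝒴` in `ℝᵈ`: the vectors with nonzero last coordinate whose
multiple of the form `(α, 1)` is of class `𝒴`. -/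
def classY {m : ℕ} (F : Set (G m)) : Set (Fin (m + 1) → ℝ) :=
  {ω | ω (Fin.last m) ≠ 0 ∧ IsYVec F (fun i : Fin m => ω i.castSucc / ω (Fin.last m))}

theorem vec_mem_classY {m : ℕ} (F : Set (G m)) (α : Fin m → ℝ) :
    vec α ∈ classY F ↔ IsYVec F α := by
  simp [classY]

/-- `DC(β)`: the vectors of `ℝᵈ` that are diophantine with exponent `β` (here `d - 1 = m`). -/
def diophantineExp (m : ℕ) (β : ℝ) : Set (Fin (m + 1) → ℝ) :=
  {ω | ∃ C : ℝ, 0 < C ∧ ∀ k : Fin (m + 1) → ℤ, k ≠ 0 →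
    C / l1Norm (intVec k) ^ ((m : ℝ) + β) < |dotProduct ω (intVec k)|}

/-- `DC`: the diophantine vectors of `ℝᵈ`. -/
def diophantine (m : ℕ) : Set (Fin (m + 1) → ℝ) :=
  {ω | ∃ β : ℝ, 0 ≤ β ∧ ω ∈ diophantineExp m β}

end TorusCF

/-! Write `W_n = P_n M_ω E^{t_n}`. Everything rests on bounding `W_n` and `W_n⁻¹` by exponentials
with small rates. In a Siegel set the last diagonal entry `b` is, up to a constant, the smallest;
since the determinant is one, `‖W‖ ≲ b^{-(d-1)}` and `‖W⁻¹‖ ≲ b⁻¹` (`exists_siegelSet_bound`). The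
last row of `W_n` comes from a nonzero integer vector transported by the flow, so a diophantine
condition of exponent `β` forces `b ≳ e^{-θt}` with `θ = β/(d+β) < 1`
(`exists_diophantine_lower_bound`). The strict inequality `θ < 1` is the heart of the matter.

Since `T_{n+1}⁻¹ = W_n E^{t_{n+1}-t_n} W_{n+1}⁻¹`, the transpose acts on a resonant `k` by `ᵗW_n`,
then the flow, then `ᵗW_{n+1}⁻¹`. The flow contracts every coordinate but the last, and the last
coordinate of `ᵗW_n k` is `γ_n (k·ω_n)`, small by resonance (`resA_le`). The contraction
`e^{-(t_{n+1}-t_n)}` beats the loss `e^{θ t_{n+1}}` as soon as `t_{n+1}` is a large multiple of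
`t_n`.

Hence take geometric stopping times and `σ_n = exp(-s t_{n+1})` with `s` large. Then `A_0⋯A_n`
decays exponentially in `t_{n+1}`, the logarithms grow at most linearly in it, and the series
converges. All the norms in the limit condition are exponentials in `t_{n+1}` with fixed rates, and
`s` outweighs them.

Full measure follows because almost every vector is diophantine: in a cube, the points violating the
condition with constant `C` have volume `O(C)`, by summing the volumes of slices over integer
vectors (`ae_exists_mul_lt_abs`). -/

namespace TorusCF

/-! ### Matrix and vector norms -/

section Norms

variable {ι : Type*} [Fintype ι]

/-- The sum of the absolute values of the entries of a matrix. -/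
def entryNorm (A : Matrix ι ι ℝ) : ℝ := ∑ i, ∑ j, |A i j|

theorem entryNorm_nonneg (A : Matrix ι ι ℝ) : 0 ≤ entryNorm A :=
  Finset.sum_nonneg fun _ _ => Finset.sum_nonneg fun _ _ => abs_nonneg _

theorem abs_entry_le_entryNorm (A : Matrix ι ι ℝ) (i j : ι) : |A i j| ≤ entryNorm A :=
  (Finset.single_le_sum (f := fun j => |A i j|) (fun _ _ => abs_nonneg _)
    (Finset.mem_univ j)).trans
  (Finset.single_le_sum (f := fun i => ∑ j, |A i j|)
    (fun _ _ => Finset.sum_nonneg fun _ _ => abs_nonneg _) (Finset.mem_univ i))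

/-- The numbers `A_n` involve transposes; this invariance is the reason to estimate with `entryNorm`
instead of the `ℓ¹` operator norm, which it dominates. -/
theorem entryNorm_transpose (A : Matrix ι ι ℝ) : entryNorm A.transpose = entryNorm A := by
  simp only [entryNorm, Matrix.transpose_apply]
  exact Finset.sum_comm

theorem entryNorm_le_of_forall_abs_le {A : Matrix ι ι ℝ} {b : ℝ} (h : ∀ i j, |A i j| ≤ b) :
    entryNorm A ≤ (Fintype.card ι : ℝ) ^ 2 * b := by
  calc entryNorm A ≤ ∑ _i : ι, ∑ _j : ι, b :=
        Finset.sum_le_sum fun i _ => Finset.sum_le_sum fun j _ => h i j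
    _ = _ := by simp; ring

theorem entryNorm_diagonal [DecidableEq ι] (a : ι → ℝ) :
    entryNorm (Matrix.diagonal a) = l1Norm a := by
  refine Finset.sum_congr rfl fun i _ => ?_
  rw [Finset.sum_eq_single i (fun j _ hj => by rw [Matrix.diagonal_apply_ne' _ hj, abs_zero])
    (by simp), Matrix.diagonal_apply_eq]

theorem l1Norm_nonneg (v : ι → ℝ) : 0 ≤ l1Norm v := Finset.sum_nonneg fun _ _ => abs_nonneg _

theorem abs_apply_le_l1Norm (v : ι → ℝ) (i : ι) : |v i| ≤ l1Norm v :=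
  Finset.single_le_sum (f := fun j => |v j|) (fun _ _ => abs_nonneg _) (Finset.mem_univ i)

theorem l1Norm_smul (r : ℝ) (v : ι → ℝ) : l1Norm (r • v) = |r| * l1Norm v := by
  simp [l1Norm, abs_mul, Finset.mul_sum]

theorem l1Norm_row_le_entryNorm (A : Matrix ι ι ℝ) (i : ι) : l1Norm (A i) ≤ entryNorm A :=
  Finset.single_le_sum (f := fun i => ∑ j, |A i j|)
    (fun _ _ => Finset.sum_nonneg fun _ _ => abs_nonneg _) (Finset.mem_univ i)

theorem l1Norm_mulVec_le_entryNorm (A : Matrix ι ι ℝ) (v : ι → ℝ) :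
    l1Norm (A.mulVec v) ≤ entryNorm A * l1Norm v := by
  unfold l1Norm entryNorm
  rw [Finset.sum_mul]
  refine Finset.sum_le_sum fun i _ => (Finset.abs_sum_le_sum_abs _ _).trans ?_
  rw [Finset.sum_mul]
  refine Finset.sum_le_sum fun j _ => ?_
  rw [abs_mul]
  exact mul_le_mul_of_nonneg_left (abs_apply_le_l1Norm v j) (abs_nonneg _)

theorem entryNorm_mul_le (A B : Matrix ι ι ℝ) :
    entryNorm (A * B) ≤ entryNorm A * entryNorm B := by
  rw [← entryNorm_transpose B, entryNorm, Finset.sum_comm]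
  conv_rhs => rw [entryNorm.eq_def B.transpose, Finset.mul_sum]
  exact Finset.sum_le_sum fun j _ => l1Norm_mulVec_le_entryNorm A (B.transpose j)

theorem one_le_l1Norm_intVec {k : ι → ℤ} (hk : k ≠ 0) : 1 ≤ l1Norm (intVec k) := by
  obtain ⟨i, hi⟩ := Function.ne_iff.mp hk
  refine le_trans ?_ (abs_apply_le_l1Norm _ i)
  simp only [intVec]
  exact_mod_cast Int.one_le_abs hi

variable [DecidableEq ι]

theorem opNorm_le_entryNorm (A : Matrix ι ι ℝ) : opNorm A ≤ entryNorm A := by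
  refine ContinuousLinearMap.opNorm_le_bound _ (entryNorm_nonneg A) fun x => ?_
  have h := l1Norm_mulVec_le_entryNorm A x.ofLp
  rw [l1Norm_eq_norm, l1Norm_eq_norm] at h
  exact h

theorem opNorm_nonneg (A : Matrix ι ι ℝ) : 0 ≤ opNorm A := norm_nonneg _

/-- Each cofactor is a determinant with entries at most `b`, the condition `1 ≤ b` absorbing the
inserted unit row, so the Leibniz formula applies. It serves to invert the unipotent factor of a
Siegel set. -/
theorem entryNorm_adjugate_le {A : Matrix ι ι ℝ} {b : ℝ} (hb : 1 ≤ b)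
    (h : ∀ i j, |A i j| ≤ b) :
    entryNorm A.adjugate ≤
      (Fintype.card ι : ℝ) ^ 2 * ((Fintype.card ι).factorial * b ^ Fintype.card ι) := by
  refine entryNorm_le_of_forall_abs_le fun i j => ?_
  rw [Matrix.adjugate_apply, ← nsmul_eq_mul]
  refine Matrix.det_le (abv := AbsoluteValue.abs) fun k l => ?_
  rw [AbsoluteValue.abs_apply, Matrix.updateRow_apply]
  split_ifs
  · by_cases hil : l = i
    · subst hil; simpa using hb
    · simpa [Pi.single_apply, hil] using zero_le_one.trans hb
  · exact h k l

theorem entryNorm_orthogonal_le {U : Matrix ι ι ℝ} (hU : U ∈ Matrix.orthogonalGroup ι ℝ) :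
    entryNorm U ≤ (Fintype.card ι : ℝ) ^ 2 := by
  simpa using entryNorm_le_of_forall_abs_le (b := 1)
    fun i j => entry_norm_bound_of_unitary (𝕜 := ℝ) hU i j

end Norms

/-! ### Diagonal factors of Siegel sets -/

section Diagonal

variable {m : ℕ}

theorem apply_last_le_pow_mul {a : Fin (m + 1) → ℝ} {c : ℝ} (hc : 1 ≤ c) (ha : ∀ i, 0 < a i)
    (h : ∀ j : Fin m, a j.succ ≤ c * a j.castSucc) (j : Fin (m + 1)) :
    a (Fin.last m) ≤ c ^ m * a j := by
  have key : a (Fin.last m) ≤ c ^ (m - (j : ℕ)) * a j := by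
    induction j using Fin.reverseInduction with
    | last => simp
    | cast j ih =>
      refine ih.trans ?_
      have e : m - (j.castSucc : ℕ) = (m - (j.succ : ℕ)) + 1 := by
        have := j.isLt
        simp only [Fin.val_castSucc, Fin.val_succ]
        omega
      rw [e, pow_succ, mul_assoc]
      exact mul_le_mul_of_nonneg_left (h j) (by positivity)
  exact key.trans (mul_le_mul_of_nonneg_right (pow_le_pow_right₀ hc (Nat.sub_le _ _)) (ha j).le)

/-- The other `m` factors contribute at least `b ^ m` to a product equal to one. -/
theorem apply_le_inv_pow_of_prod_eq_one {a : Fin (m + 1) → ℝ} (hp : ∏ i, a i = 1) {b : ℝ}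
    (hb : 0 < b) (h : ∀ i, b ≤ a i) (i : Fin (m + 1)) : a i ≤ (b⁻¹) ^ m := by
  rw [Fin.prod_univ_succAbove _ i] at hp
  have h1 : b ^ m ≤ ∏ j, a (i.succAbove j) := by
    calc b ^ m = ∏ _j : Fin m, b := by simp
      _ ≤ _ := Finset.prod_le_prod (fun _ _ => hb.le) fun j _ => h _
  have h2 : 0 < a i := hb.trans_le (h i)
  have h3 : a i * b ^ m ≤ 1 := hp ▸ mul_le_mul_of_nonneg_left h1 h2.le
  rw [inv_pow, ← one_div, le_div_iff₀ (pow_pos hb m)]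
  exact h3

end Diagonal

/-! ### Norm bounds on Siegel sets -/

section Siegel

variable {m : ℕ}

theorem siegelSet_mono {c c' C C' : ℝ} (hc : c ≤ c') (hC : C ≤ C') :
    siegelSet m c C ⊆ siegelSet m c' C' := by
  rintro M ⟨n, a, k, h1, h2, h3, h4, h5, h6, h7⟩
  exact ⟨n, a, k, h1, h2, fun i j hij => (h3 i j hij).trans hC, h4,
    fun j => (h5 j).trans (mul_le_mul_of_nonneg_right hc (h4 _).le), h6, h7⟩

/-- On a Siegel set, a matrix and its inverse are controlled by the length `b` of the last row. -/
theorem exists_siegelSet_bound (m : ℕ) {c C : ℝ} (hc : 1 ≤ c) (hC : 1 ≤ C) :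
    ∃ K : ℝ, 1 ≤ K ∧ ∀ M ∈ siegelSet m c C, ∃ b : ℝ, 0 < b ∧
      (∀ j, |M.1 (Fin.last m) j| ≤ b) ∧
      entryNorm M.1 ≤ K * (b⁻¹) ^ m ∧ entryNorm (M⁻¹).1 ≤ K * b⁻¹ := by
  set d : ℝ := (m : ℝ) + 1 with hd
  have hd1 : 1 ≤ d := by simp [hd]
  set B : ℝ := d ^ 2 * ((m + 1).factorial * C ^ (m + 1)) with hB
  have hB0 : 0 ≤ B := by positivity
  have hcm : 1 ≤ c ^ m := one_le_pow₀ hc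
  have hcmm : 1 ≤ (c ^ m) ^ m := one_le_pow₀ hcm
  refine ⟨1 + d ^ 2 * C * (d * (c ^ m) ^ m) * d ^ 2 + d ^ 2 * (d * c ^ m) * B, ?_, ?_⟩
  · have : 0 ≤ d ^ 2 * C * (d * (c ^ m) ^ m) * d ^ 2 + d ^ 2 * (d * c ^ m) * B := by positivity
    linarith
  rintro M ⟨n, a, k, h1, h2, h3, h4, h5, h6, h7⟩
  have hn : ∀ i j, |n i j| ≤ C := fun i j => by
    rcases lt_trichotomy i j with h | h | h
    · exact h3 i j h
    · subst h; rw [h1]; simpa using hC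
    · rw [h2 i j h]; simpa using zero_le_one.trans hC
  have hndet : n.det = 1 := by
    rw [Matrix.det_of_isUpperTriangular (fun i j hij => h2 i j hij)]
    simp [h1]
  have hkk : k * k.transpose = 1 := (Matrix.mem_orthogonalGroup_iff (A := k)).1 h6
  have hprod : ∏ i, a i = 1 := by
    have hdet : M.1.det = 1 := M.2
    rw [h7, Matrix.det_mul, Matrix.det_mul, hndet, one_mul, Matrix.det_diagonal] at hdet
    have h8 : k.det * k.det = 1 := by
      have := congrArg Matrix.det hkk
      rwa [Matrix.det_mul, Matrix.det_transpose, Matrix.det_one] at this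
    have h9 : 0 < ∏ i, a i := Finset.prod_pos fun i _ => h4 i
    -- The orthogonal factor has determinant `±1`; the positive diagonal excludes `-1`.
    rcases mul_self_eq_one_iff.1 h8 with h | h
    · simpa [h] using hdet
    · rw [h] at hdet; linarith
  set b := a (Fin.last m) with hb
  have hb0 : 0 < b := h4 _
  have hab : ∀ i, (c ^ m)⁻¹ * b ≤ a i := fun i => by
    rw [inv_mul_le_iff₀ (by positivity)]
    exact apply_last_le_pow_mul hc h4 h5 i
  have ha1 : ∀ i, a i ≤ (c ^ m) ^ m * (b⁻¹) ^ m := fun i => by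
    refine (apply_le_inv_pow_of_prod_eq_one hprod (by positivity) hab i).trans_eq ?_
    rw [mul_inv, inv_inv, mul_pow]
  have ha2 : ∀ i, (a i)⁻¹ ≤ c ^ m * b⁻¹ := fun i => by
    refine (inv_anti₀ (by positivity) (hab i)).trans_eq ?_
    rw [mul_inv, inv_inv]
  have hcard : ((Fintype.card (Fin (m + 1)) : ℕ) : ℝ) = d := by simp [hd]
  have hNn : entryNorm n ≤ d ^ 2 * C := by
    simpa only [hcard] using entryNorm_le_of_forall_abs_le hn
  have hNk : entryNorm k ≤ d ^ 2 := by simpa only [hcard] using entryNorm_orthogonal_le h6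
  have hNadj : entryNorm n.adjugate ≤ B := by
    have := entryNorm_adjugate_le hC hn
    rwa [hcard, Fintype.card_fin] at this
  have hNa : entryNorm (Matrix.diagonal a) ≤ d * ((c ^ m) ^ m * (b⁻¹) ^ m) := by
    rw [entryNorm_diagonal]
    calc l1Norm a ≤ ∑ _i : Fin (m + 1), (c ^ m) ^ m * (b⁻¹) ^ m :=
          Finset.sum_le_sum fun i _ => by rw [abs_of_pos (h4 i)]; exact ha1 i
      _ = _ := by simp [hd]
  have hNa' : entryNorm (Matrix.diagonal fun i => (a i)⁻¹) ≤ d * (c ^ m * b⁻¹) := by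
    rw [entryNorm_diagonal]
    calc l1Norm (fun i => (a i)⁻¹) ≤ ∑ _i : Fin (m + 1), c ^ m * b⁻¹ :=
          Finset.sum_le_sum fun i _ => by rw [abs_of_pos (inv_pos.2 (h4 i))]; exact ha2 i
      _ = _ := by simp [hd]
  -- The unipotent factor has determinant one, so its inverse is its adjugate.
  have hinv : (M⁻¹).1 = k.transpose * (Matrix.diagonal fun i => (a i)⁻¹) * n.adjugate := by
    have hM : M.1 * (k.transpose * (Matrix.diagonal fun i => (a i)⁻¹) * n.adjugate) = 1 := by
      rw [h7]
      calc n * Matrix.diagonal a * k *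
            (k.transpose * (Matrix.diagonal fun i => (a i)⁻¹) * n.adjugate)
          = n * Matrix.diagonal a * (k * k.transpose) *
            (Matrix.diagonal fun i => (a i)⁻¹) * n.adjugate := by simp only [Matrix.mul_assoc]
        _ = n * (Matrix.diagonal a * Matrix.diagonal fun i => (a i)⁻¹) * n.adjugate := by
            rw [hkk, Matrix.mul_one]; simp only [Matrix.mul_assoc]
        _ = 1 := by
            rw [Matrix.diagonal_mul_diagonal]
            simp only [mul_inv_cancel₀ (h4 _).ne', Matrix.diagonal_one, Matrix.mul_one]
            rw [Matrix.mul_adjugate, hndet, one_smul]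
    have hM' : (M⁻¹).1 * M.1 = 1 := by
      rw [← Matrix.SpecialLinearGroup.coe_mul, inv_mul_cancel, Matrix.SpecialLinearGroup.coe_one]
    exact left_inv_eq_right_inv hM' hM
  refine ⟨b, hb0, fun j => ?_, ?_, ?_⟩
  -- The last row of `n` is the last unit vector, so the last row of `M` is `b` times a row of an
  -- orthogonal matrix.
  · have hrow : M.1 (Fin.last m) j = b * k (Fin.last m) j := by
      rw [h7, Matrix.mul_assoc, Matrix.mul_apply, Finset.sum_eq_single (Fin.last m)]
      · rw [h1, one_mul, Matrix.diagonal_mul]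
      · intro i _ hi
        rw [h2 _ _ (lt_of_le_of_ne (Fin.le_last i) hi), zero_mul]
      · simp
    rw [hrow, abs_mul, abs_of_pos hb0]
    exact mul_le_of_le_one_right hb0.le (entry_norm_bound_of_unitary (𝕜 := ℝ) h6 _ j)
  · calc entryNorm M.1 ≤ entryNorm n * entryNorm (Matrix.diagonal a) * entryNorm k := by
          rw [h7]
          exact (entryNorm_mul_le _ _).trans (mul_le_mul_of_nonneg_right (entryNorm_mul_le _ _)
            (entryNorm_nonneg _))
      _ ≤ (d ^ 2 * C) * (d * ((c ^ m) ^ m * (b⁻¹) ^ m)) * d ^ 2 :=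
          mul_le_mul (mul_le_mul hNn hNa (entryNorm_nonneg _) (by positivity)) hNk
            (entryNorm_nonneg _) (by positivity)
      _ = (d ^ 2 * C * (d * (c ^ m) ^ m) * d ^ 2) * (b⁻¹) ^ m := by ring
      _ ≤ _ := by
          refine mul_le_mul_of_nonneg_right ?_ (by positivity)
          have : 0 ≤ d ^ 2 * (d * c ^ m) * B := by positivity
          linarith
  · calc entryNorm (M⁻¹).1 ≤ entryNorm k.transpose *
            entryNorm (Matrix.diagonal fun i => (a i)⁻¹) * entryNorm n.adjugate := by
          rw [hinv]
          exact (entryNorm_mul_le _ _).trans (mul_le_mul_of_nonneg_right (entryNorm_mul_le _ _)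
            (entryNorm_nonneg _))
      _ ≤ d ^ 2 * (d * (c ^ m * b⁻¹)) * B := by
          rw [entryNorm_transpose]
          exact mul_le_mul (mul_le_mul hNk hNa' (entryNorm_nonneg _) (by positivity)) hNadj
            (entryNorm_nonneg _) (by positivity)
      _ = (d ^ 2 * (d * c ^ m) * B) * b⁻¹ := by ring
      _ ≤ _ := by
          refine mul_le_mul_of_nonneg_right ?_ (by positivity)
          have : 0 ≤ d ^ 2 * C * (d * (c ^ m) ^ m) * d ^ 2 := by positivity
          linarith

end Siegel

/-! ### Renormalized matrices and the diophantine condition -/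

section Flow

variable {m : ℕ}

/-- The renormalized matrix `P M_ω E^t`. -/
noncomputable def flowW (P : Gam m) (α : Fin m → ℝ) (t : ℝ) : G m :=
  toG P * (startMatrix α * expDiag m t)

theorem startMatrix_apply_last (α : Fin m → ℝ) (i : Fin (m + 1)) :
    (startMatrix α).1 i (Fin.last m) = vec α i := by
  simp [startMatrix]

theorem startMatrix_apply_castSucc (α : Fin m → ℝ) (i : Fin (m + 1)) (j : Fin m) :
    (startMatrix α).1 i j.castSucc = (1 : Matrix (Fin (m + 1)) (Fin (m + 1)) ℝ) i j.castSucc := by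
  simp [startMatrix, (Fin.castSucc_lt_last j).ne]

/-- `M_ω` differs from the identity only in its last column. With the next lemma, row `i` of the
renormalized matrix is row `k` of `P` with its first coordinates scaled by `e^{-t}` and its last one
replaced by `e^{mt} k·ω`. -/
theorem flowW_apply_last (P : Gam m) (α : Fin m → ℝ) (t : ℝ) (i : Fin (m + 1)) :
    (flowW P α t).1 i (Fin.last m) = Real.exp (m * t) * (toMat P).mulVec (vec α) i := by
  have h : (flowW P α t).1 = toMat P * (startMatrix α).1 * (expDiag m t).1 := by
    simp [flowW, toMat, Matrix.mul_assoc]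
  rw [h, expDiag, Matrix.mul_diagonal, Fin.snoc_last, mul_comm, Matrix.mul_apply]
  simp only [startMatrix_apply_last]
  rfl

theorem flowW_apply_castSucc (P : Gam m) (α : Fin m → ℝ) (t : ℝ) (i : Fin (m + 1)) (j : Fin m) :
    (flowW P α t).1 i j.castSucc = Real.exp (-t) * toMat P i j.castSucc := by
  have h : (flowW P α t).1 = toMat P * (startMatrix α).1 * (expDiag m t).1 := by
    simp [flowW, toMat, Matrix.mul_assoc]
  rw [h, expDiag, Matrix.mul_diagonal, Fin.snoc_castSucc, mul_comm, Matrix.mul_apply]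
  simp only [startMatrix_apply_castSucc, Matrix.one_apply, mul_ite, mul_one, mul_zero,
    Finset.sum_ite_eq', Finset.mem_univ, if_true]

theorem expDiag_inv (t : ℝ) : (expDiag m t)⁻¹ = expDiag m (-t) := by
  refine inv_eq_of_mul_eq_one_right (Subtype.ext ?_)
  rw [Matrix.SpecialLinearGroup.coe_mul, Matrix.SpecialLinearGroup.coe_one]
  simp only [expDiag, Matrix.diagonal_mul_diagonal]
  rw [← Matrix.diagonal_one]
  congr 1
  funext i
  refine Fin.lastCases ?_ (fun j => ?_) i
  · simp only [Fin.snoc_last, ← Real.exp_add]; simp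
  · simp only [Fin.snoc_castSucc, ← Real.exp_add]; simp

theorem entryNorm_expDiag (t : ℝ) :
    entryNorm (expDiag m t).1 = m * Real.exp (-t) + Real.exp (m * t) := by
  simp only [expDiag, entryNorm_diagonal, l1Norm, Fin.sum_univ_castSucc, Fin.snoc_castSucc,
    Fin.snoc_last, Real.abs_exp]
  simp

theorem toG_inv (P : Gam m) : toG P⁻¹ = (toG P)⁻¹ :=
  map_inv (Matrix.SpecialLinearGroup.map (Int.castRingHom ℝ)) P

theorem toG_mul (P Q : Gam m) : toG (P * Q) = toG P * toG Q :=
  map_mul (Matrix.SpecialLinearGroup.map (Int.castRingHom ℝ)) P Q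

theorem toG_one : toG (1 : Gam m) = 1 :=
  map_one (Matrix.SpecialLinearGroup.map (Int.castRingHom ℝ))

theorem toMat_mulVec_apply (P : Gam m) (v : Fin (m + 1) → ℝ) (i : Fin (m + 1)) :
    (toMat P).mulVec v i = dotProduct v (intVec (P.1 i)) := by
  rw [dotProduct_comm]; rfl

theorem row_ne_zero (P : Gam m) (i : Fin (m + 1)) : P.1 i ≠ 0 := by
  intro h
  have h1 : P.1.det = 1 := P.2
  rw [Matrix.det_eq_zero_of_row_eq_zero i (fun j => congrFun h j)] at h1
  exact zero_ne_one h1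

theorem toG_eq_flowW_mul (P : Gam m) (α : Fin m → ℝ) (t : ℝ) :
    toG P = flowW P α t * expDiag m (-t) * (startMatrix α)⁻¹ := by
  rw [← expDiag_inv, flowW]; group

theorem toG_inv_eq_mul_flowW_inv (P : Gam m) (α : Fin m → ℝ) (t : ℝ) :
    toG P⁻¹ = startMatrix α * expDiag m t * (flowW P α t)⁻¹ := by
  rw [toG_inv, flowW]; group

theorem dotProduct_vec (α : Fin m → ℝ) (k : Fin (m + 1) → ℝ) :
    dotProduct (vec α) k = ∑ j, α j * k j.castSucc + k (Fin.last m) := by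
  simp [dotProduct, Fin.sum_univ_castSucc]

/-- A diophantine vector has no short vectors in the lattice transported by the flow. -/
theorem exists_diophantine_lower_bound {α : Fin m → ℝ} {β C : ℝ} (hβ : 0 ≤ β) (hC : 0 < C)
    (h : ∀ k : Fin (m + 1) → ℤ, k ≠ 0 →
      C / l1Norm (intVec k) ^ ((m : ℝ) + β) < |dotProduct (vec α) (intVec k)|) :
    ∃ κ : ℝ, 0 < κ ∧ ∀ (t b : ℝ) (k : Fin (m + 1) → ℤ), 0 ≤ t → 0 < b → k ≠ 0 →
      (∀ j : Fin m, Real.exp (-t) * |intVec k j.castSucc| ≤ b) →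
      Real.exp (m * t) * |dotProduct (vec α) (intVec k)| ≤ b →
      κ * Real.exp (-(β / (m + 1 + β) * t)) ≤ b := by
  set s : ℝ := m + β with hs
  have hs0 : 0 ≤ s := by positivity
  have hs1 : (m : ℝ) + 1 + β = s + 1 := by rw [hs]; ring
  set B : ℝ := ∑ j, (1 + |α j|) + 1 with hB
  have hB0 : 0 < B := by
    have : 0 ≤ ∑ j, (1 + |α j|) := Finset.sum_nonneg fun j _ => by positivity
    linarith
  refine ⟨(C / B ^ s) ^ (s + 1)⁻¹, by positivity, fun t b k ht hb hk h1 h2 => ?_⟩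
  have h1' : ∀ j : Fin m, |intVec k j.castSucc| ≤ b * Real.exp t := fun j => by
    have := h1 j
    rwa [Real.exp_neg, inv_mul_le_iff₀ (Real.exp_pos t), mul_comm] at this
  set q := |dotProduct (vec α) (intVec k)| with hq
  have h2' : q ≤ b * Real.exp (-(m * t)) := by
    rw [Real.exp_neg, ← div_eq_mul_inv, le_div_iff₀ (Real.exp_pos _), mul_comm]
    exact h2
  have h2'' : q ≤ b * Real.exp t := by
    refine h2'.trans (mul_le_mul_of_nonneg_left (Real.exp_le_exp.2 ?_) hb.le)
    have : 0 ≤ (m : ℝ) * t := by positivity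
    linarith
  -- The last coordinate of `k` is recovered from `k·ω` and the other ones, which explains the
  -- constant `B`.
  have hl : l1Norm (intVec k) ≤ B * (b * Real.exp t) := by
    have hlast : |intVec k (Fin.last m)| ≤ q + ∑ j, |α j| * (b * Real.exp t) := by
      have e : intVec k (Fin.last m) =
          dotProduct (vec α) (intVec k) - ∑ j, α j * intVec k j.castSucc := by
        rw [dotProduct_vec]; ring
      rw [e]
      refine (abs_sub _ _).trans (add_le_add le_rfl ((Finset.abs_sum_le_sum_abs _ _).trans ?_))
      refine Finset.sum_le_sum fun j _ => ?_
      rw [abs_mul]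
      exact mul_le_mul_of_nonneg_left (h1' j) (abs_nonneg _)
    have hsum : ∑ j : Fin m, |intVec k j.castSucc| ≤ ∑ _j : Fin m, b * Real.exp t :=
      Finset.sum_le_sum fun j _ => h1' j
    rw [l1Norm, Fin.sum_univ_castSucc]
    calc _ ≤ ∑ _j : Fin m, b * Real.exp t +
          (b * Real.exp t + ∑ j, |α j| * (b * Real.exp t)) := by linarith
      _ = B * (b * Real.exp t) := by
        rw [hB, add_mul, Finset.sum_mul]
        simp only [add_mul, one_mul, Finset.sum_add_distrib]
        ring
  have hl0 : 0 < l1Norm (intVec k) := zero_lt_one.trans_le (one_le_l1Norm_intVec hk)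
  have key : C ≤ (b * Real.exp (-(m * t))) * (B * (b * Real.exp t)) ^ s := by
    have h3 := (h k hk).le
    rw [div_le_iff₀ (by positivity)] at h3
    exact h3.trans (mul_le_mul h2' (Real.rpow_le_rpow hl0.le hl hs0) (by positivity)
      (by positivity))
  -- With `s = m + β`, the net exponent `-m + s` is `β`, while `b` occurs to the power `s + 1`: this
  -- is where `θ = β / (m + 1 + β)` comes from.
  have e : (b * Real.exp (-(m * t))) * (B * (b * Real.exp t)) ^ s =
      B ^ s * (b * Real.exp (β / (s + 1) * t)) ^ (s + 1) := by
    rw [Real.mul_rpow hB0.le (by positivity), Real.mul_rpow hb.le (Real.exp_pos _).le,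
      Real.mul_rpow hb.le (Real.exp_pos _).le, ← Real.exp_mul, ← Real.exp_mul,
      Real.rpow_add_one hb.ne']
    have e1 : β / (s + 1) * t * (s + 1) = -(m * t) + t * s := by
      rw [hs]; field_simp; ring
    rw [e1, Real.exp_add]; ring
  rw [e, ← div_le_iff₀' (by positivity)] at key
  rw [hs1, Real.exp_neg, ← div_eq_mul_inv, div_le_iff₀ (Real.exp_pos _)]
  exact (Real.rpow_inv_le_iff_of_pos (by positivity) (by positivity) (by positivity)).2 key

/-- The exponential bounds on the renormalized matrix `P M_ω E^t` and on `P`. -/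
structure FlowBound (α : Fin m → ℝ) (θ L K : ℝ) (P : Gam m) (t : ℝ) : Prop where
  flow : entryNorm (flowW P α t).1 ≤ K * Real.exp (m * θ * t)
  flow_inv : entryNorm ((flowW P α t)⁻¹).1 ≤ K * Real.exp (θ * t)
  mat : entryNorm (toMat P) ≤ K * Real.exp (L * t)
  mat_inv : entryNorm (toMat P⁻¹) ≤ K * Real.exp (L * t)
  vec_le : l1Norm ((toMat P).mulVec (vec α)) ≤ K * Real.exp (L * t)
  le_last : 1 ≤ K * Real.exp (L * t) * |(toMat P).mulVec (vec α) (Fin.last m)|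

theorem FlowBound.mono {α : Fin m → ℝ} {θ L K K' : ℝ} {P : Gam m} {t : ℝ}
    (h : FlowBound α θ L K P t) (hK : K ≤ K') : FlowBound α θ L K' P t where
  flow := h.flow.trans (by gcongr)
  flow_inv := h.flow_inv.trans (by gcongr)
  mat := h.mat.trans (by gcongr)
  mat_inv := h.mat_inv.trans (by gcongr)
  vec_le := h.vec_le.trans (by gcongr)
  le_last := h.le_last.trans (by gcongr)

/-- Index `0` is separate: `P_0 = I` is imposed, and `M_ω` need not lie in the fundamental domain.
-/
theorem exists_flowBound_one (α : Fin m → ℝ) (θ L : ℝ) :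
    ∃ K : ℝ, FlowBound α θ L K 1 0 := by
  set a := entryNorm (flowW 1 α 0).1
  set b := entryNorm ((flowW 1 α 0)⁻¹).1
  set c := entryNorm (toMat (1 : Gam m))
  set e := l1Norm ((toMat (1 : Gam m)).mulVec (vec α))
  have ha : 0 ≤ a := entryNorm_nonneg _
  have hb : 0 ≤ b := entryNorm_nonneg _
  have hc : 0 ≤ c := entryNorm_nonneg _
  have he : 0 ≤ e := l1Norm_nonneg _
  have h1 : toMat (1 : Gam m) = 1 := by simp [toMat, toG_one]
  refine ⟨1 + a + b + c + e, ?_, ?_, ?_, ?_, ?_, ?_⟩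
  · simp only [mul_zero, Real.exp_zero, mul_one]; linarith
  · simp only [mul_zero, Real.exp_zero, mul_one]; linarith
  · simp only [mul_zero, Real.exp_zero, mul_one]; linarith
  · simp only [mul_zero, Real.exp_zero, mul_one, inv_one]; linarith
  · simp only [mul_zero, Real.exp_zero, mul_one]; linarith
  · simp only [mul_zero, Real.exp_zero, mul_one, h1, Matrix.one_mulVec, vec_last, abs_one]
    linarith

-- The flow bounds combine the Siegel estimate with the lower bound on `b`; those on `P` and `P⁻¹`
-- follow by undoing the flow and `M_ω`, at rate `m + 1`. The last component of `P ω` is bounded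
-- below by the diophantine condition on the last row of `P`, which raises that rate to `(m + 1) (m
-- + β)`. The single rate `(m + 1) (m + 1 + β)` dominates both.
set_option maxHeartbeats 800000 in
theorem exists_flowBound_siegel {α : Fin m → ℝ} {β C c₁ C₁ : ℝ} (hβ : 0 ≤ β) (hC : 0 < C)
    (h : ∀ k : Fin (m + 1) → ℤ, k ≠ 0 →
      C / l1Norm (intVec k) ^ ((m : ℝ) + β) < |dotProduct (vec α) (intVec k)|) :
    ∃ K : ℝ, ∀ (P : Gam m) (t : ℝ), 0 ≤ t → flowW P α t ∈ siegelSet m c₁ C₁ →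
      FlowBound α (β / (m + 1 + β)) ((m + 1) * (m + 1 + β)) K P t := by
  -- The Siegel parameters are raised to at least `1`, which only enlarges the set.
  obtain ⟨S, hS1, hS⟩ := exists_siegelSet_bound m (le_max_right c₁ 1) (le_max_right C₁ 1)
  obtain ⟨κ, hκ, hb⟩ := exists_diophantine_lower_bound hβ hC h
  set θ := β / (m + 1 + β) with hθ
  set s : ℝ := m + β with hs
  have hs0 : 0 ≤ s := by positivity
  have hθ0 : 0 ≤ θ := by positivity
  have hθ1 : θ ≤ 1 := by
    rw [hθ, div_le_one (by positivity)]
    have : (0 : ℝ) ≤ m := by positivity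
    linarith
  set K1 : ℝ := S * κ⁻¹ ^ m + S * κ⁻¹ with hK1
  have hK1p : 0 < K1 := by positivity
  set R := entryNorm (startMatrix α).1 + entryNorm ((startMatrix α)⁻¹).1 + 1 with hR
  have hR1 := entryNorm_nonneg (startMatrix α).1
  have hR2 := entryNorm_nonneg ((startMatrix α)⁻¹).1
  set K2 : ℝ := K1 * (m + 1) * R with hK2
  have hK2p : 0 < K2 := by positivity
  set v := l1Norm (vec α) with hv
  have hv0 : 0 ≤ v := l1Norm_nonneg _
  refine ⟨K1 + K2 + K2 * v + C⁻¹ * K2 ^ s, fun P t ht hW => ?_⟩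
  have hK3p : 0 ≤ K2 * v := by positivity
  have hK4p : 0 ≤ C⁻¹ * K2 ^ s := by positivity
  obtain ⟨b, hb0, hrow, hN, hNi⟩ := hS _ (siegelSet_mono (le_max_left _ _) (le_max_left _ _) hW)
  -- The diophantine bound is applied to the last row of `P`, nonzero because `det P = 1`.
  have hblow : κ * Real.exp (-(θ * t)) ≤ b := by
    refine hb t b (P.1 (Fin.last m)) ht hb0 (row_ne_zero P _) (fun j => ?_) ?_
    · have := hrow j.castSucc
      rwa [flowW_apply_castSucc, abs_mul, Real.abs_exp] at this
    · have := hrow (Fin.last m)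
      rwa [flowW_apply_last, abs_mul, Real.abs_exp, toMat_mulVec_apply] at this
  have hbinv : b⁻¹ ≤ κ⁻¹ * Real.exp (θ * t) := by
    refine (inv_anti₀ (by positivity) hblow).trans_eq ?_
    rw [mul_inv, Real.exp_neg, inv_inv]
  have hflow : entryNorm (flowW P α t).1 ≤ K1 * Real.exp (m * θ * t) := by
    have h2 : b⁻¹ ^ m ≤ κ⁻¹ ^ m * Real.exp (m * θ * t) := by
      refine (pow_le_pow_left₀ (by positivity) hbinv m).trans_eq ?_
      rw [mul_pow, ← Real.exp_nat_mul, mul_assoc]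
    calc _ ≤ S * (κ⁻¹ ^ m * Real.exp (m * θ * t)) := hN.trans (by gcongr)
      _ = S * κ⁻¹ ^ m * Real.exp (m * θ * t) := by ring
      _ ≤ _ := by
        refine mul_le_mul_of_nonneg_right ?_ (Real.exp_pos _).le
        have : 0 ≤ S * κ⁻¹ := by positivity
        linarith
  have hflowi : entryNorm ((flowW P α t)⁻¹).1 ≤ K1 * Real.exp (θ * t) := by
    calc _ ≤ S * (κ⁻¹ * Real.exp (θ * t)) := hNi.trans (by gcongr)
      _ = S * κ⁻¹ * Real.exp (θ * t) := by ring
      _ ≤ _ := by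
        refine mul_le_mul_of_nonneg_right ?_ (Real.exp_pos _).le
        have : 0 ≤ S * κ⁻¹ ^ m := by positivity
        linarith
  have hm0 : (0 : ℝ) ≤ m := by positivity
  have hmt : 0 ≤ (m : ℝ) * t := by positivity
  have hE1 : entryNorm (expDiag m (-t)).1 ≤ (m + 1) * Real.exp t := by
    rw [entryNorm_expDiag, neg_neg, add_mul, one_mul]
    have : Real.exp (m * -t) ≤ Real.exp t := Real.exp_le_exp.2 (by linarith)
    linarith
  have hE2 : entryNorm (expDiag m t).1 ≤ (m + 1) * Real.exp (m * t) := by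
    rw [entryNorm_expDiag, add_mul, one_mul]
    have : Real.exp (-t) ≤ Real.exp (m * t) := Real.exp_le_exp.2 (by linarith)
    have := mul_le_mul_of_nonneg_left this hm0
    linarith
  have hmat : entryNorm (toMat P) ≤ K2 * Real.exp ((m + 1) * t) := by
    rw [toMat, toG_eq_flowW_mul P α t, Matrix.SpecialLinearGroup.coe_mul,
      Matrix.SpecialLinearGroup.coe_mul]
    calc _ ≤ entryNorm (flowW P α t).1 * entryNorm (expDiag m (-t)).1 *
          entryNorm ((startMatrix α)⁻¹).1 :=
        (entryNorm_mul_le _ _).trans (mul_le_mul_of_nonneg_right (entryNorm_mul_le _ _) hR2)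
      _ ≤ (K1 * Real.exp (m * θ * t)) * ((m + 1) * Real.exp t) * R :=
        mul_le_mul (mul_le_mul hflow hE1 (entryNorm_nonneg _) (by positivity)) (by linarith) hR2
          (by positivity)
      _ = K2 * Real.exp (m * θ * t + t) := by rw [hK2, Real.exp_add]; ring
      _ ≤ _ := by
        refine mul_le_mul_of_nonneg_left (Real.exp_le_exp.2 ?_) hK2p.le
        nlinarith
  have hmati : entryNorm (toMat P⁻¹) ≤ K2 * Real.exp ((m + 1) * t) := by
    rw [toMat, toG_inv_eq_mul_flowW_inv P α t, Matrix.SpecialLinearGroup.coe_mul,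
      Matrix.SpecialLinearGroup.coe_mul]
    calc _ ≤ entryNorm (startMatrix α).1 * entryNorm (expDiag m t).1 *
          entryNorm ((flowW P α t)⁻¹).1 :=
        (entryNorm_mul_le _ _).trans (mul_le_mul_of_nonneg_right (entryNorm_mul_le _ _)
          (entryNorm_nonneg _))
      _ ≤ R * ((m + 1) * Real.exp (m * t)) * (K1 * Real.exp (θ * t)) :=
        mul_le_mul (mul_le_mul (by linarith) hE2 (entryNorm_nonneg _) (by positivity)) hflowi
          (entryNorm_nonneg _) (by positivity)
      _ = K2 * Real.exp (m * t + θ * t) := by rw [hK2, Real.exp_add]; ring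
      _ ≤ _ := by
        refine mul_le_mul_of_nonneg_left (Real.exp_le_exp.2 ?_) hK2p.le
        nlinarith
  have hexp : Real.exp ((m + 1) * t) ≤ Real.exp ((m + 1) * (m + 1 + β) * t) := by
    refine Real.exp_le_exp.2 (mul_le_mul_of_nonneg_right ?_ ht)
    nlinarith
  refine ⟨hflow.trans ?_, hflowi.trans ?_, hmat.trans ?_, hmati.trans ?_, ?_, ?_⟩
  · exact mul_le_mul_of_nonneg_right (by linarith) (Real.exp_pos _).le
  · exact mul_le_mul_of_nonneg_right (by linarith) (Real.exp_pos _).le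
  · exact mul_le_mul (by linarith) hexp (Real.exp_pos _).le (by linarith)
  · exact mul_le_mul (by linarith) hexp (Real.exp_pos _).le (by linarith)
  · calc _ ≤ K2 * Real.exp ((m + 1) * t) * v :=
        (l1Norm_mulVec_le_entryNorm _ _).trans (mul_le_mul_of_nonneg_right hmat hv0)
      _ = K2 * v * Real.exp ((m + 1) * t) := by ring
      _ ≤ _ := mul_le_mul (by linarith) hexp (Real.exp_pos _).le (by linarith)
  · have hk := row_ne_zero P (Fin.last m)
    have h3 := h _ hk
    set l := l1Norm (intVec (P.1 (Fin.last m)))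
    have hl1 : 1 ≤ l := one_le_l1Norm_intVec hk
    have hl0 : 0 < l := by linarith
    have hl : l ≤ K2 * Real.exp ((m + 1) * t) :=
      (l1Norm_row_le_entryNorm (toMat P) (Fin.last m)).trans hmat
    rw [toMat_mulVec_apply]
    set q := |dotProduct (vec α) (intVec (P.1 (Fin.last m)))|
    have hq : 0 ≤ q := abs_nonneg _
    have h4 : 1 ≤ C⁻¹ * (l ^ s * q) := by
      rw [div_lt_iff₀ (by positivity)] at h3
      rw [← div_eq_inv_mul, le_div_iff₀ hC]
      linarith
    have h5 : l ^ s ≤ K2 ^ s * Real.exp ((m + 1) * (m + 1 + β) * t) := by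
      refine (Real.rpow_le_rpow hl0.le hl hs0).trans ?_
      rw [Real.mul_rpow hK2p.le (Real.exp_pos _).le, ← Real.exp_mul]
      refine mul_le_mul_of_nonneg_left (Real.exp_le_exp.2 ?_) (by positivity)
      rw [hs]
      nlinarith
    calc 1 ≤ C⁻¹ * (l ^ s * q) := h4
      _ ≤ C⁻¹ * ((K2 ^ s * Real.exp ((m + 1) * (m + 1 + β) * t)) * q) := by gcongr
      _ = C⁻¹ * K2 ^ s * Real.exp ((m + 1) * (m + 1 + β) * t) * q := by ring
      _ ≤ _ := by
        refine mul_le_mul_of_nonneg_right (mul_le_mul_of_nonneg_right ?_ (Real.exp_pos _).le) hq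
        linarith

/-- For a diophantine vector, the renormalized matrices grow at most exponentially with small
rates, uniformly in the time. -/
theorem exists_flowBound {α : Fin m → ℝ} (h : vec α ∈ diophantine m) {F : Set (G m)}
    {c C : ℝ} (hS : F ⊆ siegelSet m c C) :
    ∃ θ L K : ℝ, θ < 1 ∧ 0 ≤ L ∧ 1 ≤ K ∧ FlowBound α θ L K 1 0 ∧
      ∀ (P : Gam m) (t : ℝ), 0 ≤ t → flowW P α t ∈ F → FlowBound α θ L K P t := by
  obtain ⟨β, hβ, C', hC', h⟩ := h
  obtain ⟨K, hK⟩ := exists_flowBound_siegel (c₁ := c) (C₁ := C) hβ hC' h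
  obtain ⟨K', hK'⟩ := exists_flowBound_one α (β / (m + 1 + β)) ((m + 1) * (m + 1 + β))
  refine ⟨β / (m + 1 + β), (m + 1) * (m + 1 + β), max 1 (max K K'), ?_,
    by positivity, le_max_left _ _, hK'.mono ?_, fun P t ht hP => (hK P t ht (hS hP)).mono ?_⟩
  · rw [div_lt_one (by positivity)]
    have : (0 : ℝ) ≤ m := by positivity
    linarith
  · exact (le_max_right _ _).trans (le_max_right _ _)
  · exact (le_max_left _ _).trans (le_max_right _ _)

end Flow

/-! ### Transfer matrices and the contraction of resonant cones -/

section Expansion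

variable {m : ℕ} {F : Set (G m)} {α : Fin m → ℝ} {t : ℕ → ℝ}

theorem expDiag_add (s t : ℝ) : expDiag m (s + t) = expDiag m s * expDiag m t := by
  refine Subtype.ext ?_
  rw [Matrix.SpecialLinearGroup.coe_mul]
  simp only [expDiag, Matrix.diagonal_mul_diagonal]
  congr 1
  funext i
  refine Fin.lastCases ?_ (fun j => ?_) i
  · simp only [Fin.snoc_last, ← Real.exp_add]; congr 1; ring
  · simp only [Fin.snoc_castSucc, ← Real.exp_add]; congr 1; ring

theorem flowW_mul_expDiag (P : Gam m) (α : Fin m → ℝ) (s t : ℝ) :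
    flowW P α s * expDiag m (t - s) = flowW P α t := by
  rw [flowW, flowW, mul_assoc, mul_assoc, ← expDiag_add, add_sub_cancel]

/-- `M_ω` cancels, so a transfer matrix is a piece of the flow between two renormalized matrices. -/
theorem toG_mul_inv (P Q : Gam m) (α : Fin m → ℝ) (s t : ℝ) :
    toG (Q * P⁻¹) = flowW Q α t * expDiag m (s - t) * (flowW P α s)⁻¹ := by
  rw [flowW_mul_expDiag, toG_mul, toG_inv, flowW, flowW]; group

theorem cfLambda_eq (n : ℕ) :
    cfLambda F α t n = ((toMat (cfP F α t n)).mulVec (vec α) (Fin.last m))⁻¹ := by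
  rw [cfLambda, cfGamma, div_mul_cancel_left₀ (Real.exp_pos _).ne']

/-- Since `γ_n λ_n = e^{m t_n}`, the vector `γ_n ω_n` is the last column of the renormalized matrix.
This turns the resonance condition into smallness of a single coordinate. -/
theorem cfGamma_mul_cfOmega {n : ℕ} (h : cfGamma F α t n ≠ 0) (i : Fin (m + 1)) :
    cfGamma F α t n * cfOmega F α t n i =
      (flowW (cfP F α t n) α (t n)).1 i (Fin.last m) := by
  rw [flowW_apply_last, cfOmega, cfLambda, Pi.smul_apply, smul_eq_mul]
  field_simp

theorem cfGamma_eq (n : ℕ) : cfGamma F α t n =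
    (flowW (cfP F α t n) α (t n)).1 (Fin.last m) (Fin.last m) := by
  rw [flowW_apply_last, cfGamma]

theorem l1Norm_expDiag_mulVec (s : ℝ) (u : Fin (m + 1) → ℝ) :
    l1Norm ((expDiag m s).1.mulVec u) ≤
      Real.exp (-s) * l1Norm u + Real.exp (m * s) * |u (Fin.last m)| := by
  simp only [expDiag, l1Norm, Matrix.mulVec_diagonal, Fin.sum_univ_castSucc, Fin.snoc_castSucc,
    Fin.snoc_last, abs_mul, Real.abs_exp, mul_add, Finset.mul_sum]
  have : 0 ≤ Real.exp (-s) * |u (Fin.last m)| := by positivity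
  linarith

theorem resA_nonneg (σ : ℕ → ℝ) (n : ℕ) : 0 ≤ resA F α t σ n := by
  refine Real.sSup_nonneg ?_
  rintro r ⟨k, -, -, rfl⟩
  exact div_nonneg (l1Norm_nonneg _) (l1Norm_nonneg _)

/-- The contraction of the resonant cone, in terms of the renormalized matrices. -/
theorem resA_le {σ : ℕ → ℝ} {n : ℕ} (hσ : 0 ≤ σ n) (hγ : cfGamma F α t n ≠ 0) :
    resA F α t σ n ≤ entryNorm ((flowW (cfP F α t (n + 1)) α (t (n + 1)))⁻¹).1 *
      (entryNorm (flowW (cfP F α t n) α (t n)).1 *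
        (Real.exp (-(t (n + 1) - t n)) + Real.exp (m * (t (n + 1) - t n)) * σ n)) := by
  set W := flowW (cfP F α t n) α (t n) with hW
  set W' := flowW (cfP F α t (n + 1)) α (t (n + 1)) with hW'
  set δ := t (n + 1) - t n with hδ
  have hN := entryNorm_nonneg W.1
  have hN' := entryNorm_nonneg (W'⁻¹).1
  -- Nonnegativity of the bound also covers a cone without nonzero vectors, where the supremum is
  -- `0` by convention.
  refine Real.sSup_le ?_ (by positivity)
  rintro r ⟨k, hk, hk0, rfl⟩
  have hl : 0 < l1Norm (intVec k) := zero_lt_one.trans_le (one_le_l1Norm_intVec hk0)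
  rw [div_le_iff₀ hl]
  have hT : toMat (cfT F α t (n + 1))⁻¹ = W.1 * (expDiag m δ).1 * (W'⁻¹).1 := by
    have : (cfT F α t (n + 1))⁻¹ = cfP F α t n * (cfP F α t (n + 1))⁻¹ := by simp [cfT]
    rw [this, toMat, toG_mul_inv _ _ α (t (n + 1)) (t n), Matrix.SpecialLinearGroup.coe_mul,
      Matrix.SpecialLinearGroup.coe_mul]
  have hE : (expDiag m δ).1.transpose = (expDiag m δ).1 := Matrix.diagonal_transpose _
  rw [hT, Matrix.transpose_mul, Matrix.transpose_mul, hE, ← Matrix.mulVec_mulVec,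
    ← Matrix.mulVec_mulVec]
  set u := W.1.transpose.mulVec (intVec k) with hu
  have hu1 : l1Norm u ≤ entryNorm W.1 * l1Norm (intVec k) := by
    rw [← entryNorm_transpose]; exact l1Norm_mulVec_le_entryNorm _ _
  -- Resonance is used here: the expanded coordinate is `γ_n (k·ω_n)`, and `γ_n` is itself an entry
  -- of `W`.
  have hu2 : |u (Fin.last m)| ≤ entryNorm W.1 * (σ n * l1Norm (intVec k)) := by
    have e : u (Fin.last m) = cfGamma F α t n * dotProduct (intVec k) (cfOmega F α t n) := by
      rw [hu, Matrix.mulVec_transpose, Matrix.vecMul, dotProduct, dotProduct, Finset.mul_sum]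
      refine Finset.sum_congr rfl fun i _ => ?_
      rw [hW, ← cfGamma_mul_cfOmega hγ]; ring
    rw [e, abs_mul]
    refine mul_le_mul ?_ hk (abs_nonneg _) hN
    rw [cfGamma_eq]
    exact abs_entry_le_entryNorm _ _ _
  calc l1Norm ((W'⁻¹).1.transpose.mulVec ((expDiag m δ).1.mulVec u))
      ≤ entryNorm (W'⁻¹).1 *
        (Real.exp (-δ) * l1Norm u + Real.exp (m * δ) * |u (Fin.last m)|) := by
        refine (l1Norm_mulVec_le_entryNorm _ _).trans ?_
        rw [entryNorm_transpose]
        exact mul_le_mul_of_nonneg_left (l1Norm_expDiag_mulVec δ u) hN'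
    _ ≤ entryNorm (W'⁻¹).1 * (Real.exp (-δ) * (entryNorm W.1 * l1Norm (intVec k)) +
        Real.exp (m * δ) * (entryNorm W.1 * (σ n * l1Norm (intVec k)))) := by gcongr
    _ = _ := by ring

/-- If `P` does not change, the two renormalized matrices differ by the flow alone, whose last
diagonal entry is the left side. For well separated times this will be contradictory. -/
theorem exp_le_of_cfP_eq {n : ℕ} (h : cfP F α t (n + 1) = cfP F α t n) :
    Real.exp (m * (t (n + 1) - t n)) ≤
      entryNorm ((flowW (cfP F α t n) α (t n))⁻¹).1 *
        entryNorm (flowW (cfP F α t (n + 1)) α (t (n + 1))).1 := by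
  have e : (flowW (cfP F α t n) α (t n))⁻¹ * flowW (cfP F α t (n + 1)) α (t (n + 1)) =
      expDiag m (t (n + 1) - t n) := by
    rw [h, ← flowW_mul_expDiag _ α (t n) (t (n + 1)), inv_mul_cancel_left]
  refine le_trans ?_ (entryNorm_mul_le _ _)
  rw [← Matrix.SpecialLinearGroup.coe_mul, e]
  refine le_trans (le_of_eq ?_) (abs_entry_le_entryNorm _ (Fin.last m) (Fin.last m))
  simp [expDiag]

/-- The image of the first basis vector is a nonzero integer vector. -/
theorem one_le_opNorm_toMat (P : Gam m) : 1 ≤ opNorm (toMat P) := by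
  have h := l1Norm_mulVec_le (toMat P) (Pi.single 0 1)
  have h1 : l1Norm (Pi.single (0 : Fin (m + 1)) (1 : ℝ)) = 1 := by
    rw [l1Norm, Finset.sum_eq_single 0 (fun j _ hj => by simp [hj]) (by simp)]
    simp
  rw [h1, mul_one, Matrix.mulVec_single_one] at h
  refine le_trans ?_ h
  have h2 : (fun i => P.1 i 0) ≠ 0 := fun h0 => by
    have hd : P.1.det = 1 := P.2
    rw [Matrix.det_eq_zero_of_column_eq_zero 0 (fun i => congrFun h0 i)] at hd
    exact zero_ne_one hd
  exact one_le_l1Norm_intVec h2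

theorem flowBound_cfP (hF : IsFundDomain F) {θ L K : ℝ} (h1 : FlowBound α θ L K 1 0)
    (h : ∀ (P : Gam m) (t : ℝ), 0 ≤ t → flowW P α t ∈ F → FlowBound α θ L K P t)
    (ht0 : t 0 = 0) (ht : ∀ n, 0 ≤ t n) (n : ℕ) : FlowBound α θ L K (cfP F α t n) (t n) := by
  cases n with
  | zero => rw [ht0]; exact h1
  | succ n => exact h _ _ (ht _) (flowP_mem hF α _)

theorem cfT_zero_eq : cfT F α t 0 = cfP F α t 0 * (cfP F α t 0)⁻¹ := by simp [cfT]

end Expansion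

/-! ### Fast stopping times and elementary estimates -/

/-- Stopping times that grow fast enough, relative to the constants of `FlowBound`. -/
structure IsFastTimes (m : ℕ) (ε K ρ : ℝ) (t : ℕ → ℝ) : Prop where
  zero : t 0 = 0
  mul_le : ∀ n, ((m : ℝ) + 1) * t n ≤ ε * t (n + 1)
  two_mul_le : ∀ n, 2 * t n ≤ t (n + 1)
  le_mul : ∀ n, t (n + 2) ≤ ρ * t (n + 1)
  succ_le : ∀ n : ℕ, (n : ℝ) + 1 ≤ t (n + 1)
  le_exp : ∀ n, 2 * K ^ 2 ≤ Real.exp (ε / 2 * t (n + 1))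
  summable : Summable fun n => (t (n + 1))⁻¹

/-- Take `t_n = τ ρ^n` for `n ≥ 1` and `t_0 = 0`. The ratio `ρ` gives the separation of times, and
`τ` absorbs the constant `2 K ^ 2`. The growth is only geometric because `log (σ_n / σ_{n+1})` has
to remain `O(t_{n+1})`. -/
theorem exists_isFastTimes (m : ℕ) {ε : ℝ} (hε : 0 < ε) {K : ℝ} (hK : 1 ≤ K) :
    ∃ (ρ : ℝ) (t : ℕ → ℝ), 0 ≤ ρ ∧ IsFastTimes m ε K ρ t := by
  set ρ : ℝ := 2 + (m + 1) / ε with hρ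
  have hρ2 : 2 ≤ ρ := by
    have : 0 ≤ ((m : ℝ) + 1) / ε := by positivity
    linarith
  have hρε : (m : ℝ) + 1 ≤ ε * ρ := by
    have : ε * (((m : ℝ) + 1) / ε) = m + 1 := by field_simp
    rw [hρ, mul_add, this]; linarith
  set τ : ℝ := 1 + 2 / ε * Real.log (2 * K ^ 2) with hτ
  have hK2 : 1 ≤ 2 * K ^ 2 := by nlinarith
  have hτ1 : 1 ≤ τ := by
    have := Real.log_nonneg hK2
    have : 0 ≤ 2 / ε * Real.log (2 * K ^ 2) := by positivity
    linarith
  have hτK : 2 * K ^ 2 ≤ Real.exp (ε / 2 * τ) := by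
    rw [← Real.log_le_iff_le_exp (by linarith), hτ, mul_add]
    have : ε / 2 * (2 / ε * Real.log (2 * K ^ 2)) = Real.log (2 * K ^ 2) := by field_simp
    rw [this]; linarith
  set t : ℕ → ℝ := fun n => if n = 0 then 0 else τ * ρ ^ n with ht
  have hs : ∀ n, t (n + 1) = τ * ρ ^ (n + 1) := fun n => by simp [ht]
  have hnn : ∀ n, 0 ≤ t n := fun n => by
    simp only [ht]; split_ifs
    · exact le_rfl
    · positivity
  have hmul : ∀ n, ρ * t n ≤ t (n + 1) := fun n => by
    cases n with
    | zero => rw [hs]; simp only [ht, if_true, mul_zero]; positivity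
    | succ n => rw [hs, hs, pow_succ ρ (n + 1)]; exact le_of_eq (by ring)
  have hle : ∀ n, ρ ^ (n + 1) ≤ t (n + 1) := fun n => by
    rw [hs]; exact le_mul_of_one_le_left (by positivity) hτ1
  refine ⟨ρ, t, by linarith, by simp [ht], fun n => ?_, fun n => ?_, fun n => ?_, fun n => ?_,
    fun n => ?_, ?_⟩
  · calc ((m : ℝ) + 1) * t n ≤ ε * ρ * t n := mul_le_mul_of_nonneg_right hρε (hnn n)
      _ = ε * (ρ * t n) := by ring
      _ ≤ _ := mul_le_mul_of_nonneg_left (hmul n) hε.le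
  · exact (mul_le_mul_of_nonneg_right hρ2 (hnn n)).trans (hmul n)
  · rw [hs, hs, pow_succ ρ (n + 1)]; exact le_of_eq (by ring)
  · refine le_trans ?_ ((pow_le_pow_left₀ (by norm_num) hρ2 (n + 1)).trans (hle n))
    exact_mod_cast (Nat.lt_two_pow_self (n := n + 1)).le
  · refine hτK.trans (Real.exp_le_exp.2 (mul_le_mul_of_nonneg_left ?_ (by positivity)))
    rw [hs]
    exact le_mul_of_one_le_right (by linarith) (one_le_pow₀ (by linarith))
  · have hg : Summable fun n : ℕ => (ρ⁻¹) ^ (n + 1) :=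
      (summable_nat_add_iff 1).2 (summable_geometric_of_lt_one (by positivity)
        (inv_lt_one_of_one_lt₀ (by linarith)))
    refine Summable.of_nonneg_of_le (fun n => inv_nonneg.2 (hnn _)) (fun n => ?_) hg
    rw [inv_pow]
    exact inv_anti₀ (by positivity) (hle n)

/-- In the application `x` is a product of `|η|`, `‖T‖`, `‖ω‖`, each at most `q ^ 2`, and of the
ratio of widths, at most `exp e`. Only `|η|` can be less than one, and it is at least `q⁻²`. -/
theorem abs_log_le {x q e : ℝ} (hq : 1 ≤ q) (he : 0 ≤ e) (h1 : 1 ≤ x * q ^ 2)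
    (h2 : x ≤ q ^ 6 * Real.exp e) : |Real.log x| ≤ 6 * Real.log q + e := by
  have hq0 : 0 < q := by linarith
  have hx : 0 < x := pos_of_mul_pos_left (zero_lt_one.trans_le h1) (by positivity)
  have hlq := Real.log_nonneg hq
  have h3 := Real.log_le_log hx h2
  have h4 := Real.log_nonneg h1
  rw [Real.log_mul (by positivity) (by positivity), Real.log_pow, Real.log_exp] at h3
  rw [Real.log_mul (by positivity) (by positivity), Real.log_pow] at h4
  push_cast at h3 h4
  rw [abs_le]
  constructor <;> linarith

/-- From `e^y ≥ y²/2`; it reduces the convergence of the series to that of `∑ 1 / t_{n+1}`. -/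
theorem exp_neg_mul_mul_le {a x : ℝ} (ha : 0 < a) (hx : 0 < x) :
    Real.exp (-(a * x)) * x ≤ 2 / a ^ 2 * x⁻¹ := by
  have h := Real.quadratic_le_exp_of_nonneg (x := a * x) (by positivity)
  have h1 : (a * x) ^ 2 / 2 ≤ Real.exp (a * x) := by
    have : 0 ≤ a * x := by positivity
    linarith
  rw [Real.exp_neg, inv_mul_le_iff₀ (Real.exp_pos _)]
  calc x = (a * x) ^ 2 / 2 * (2 / a ^ 2 * x⁻¹) := by field_simp
    _ ≤ _ := by gcongr

namespace IsFastTimes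

variable {m : ℕ} {ε K ρ : ℝ} {t : ℕ → ℝ}

theorem nonneg (h : IsFastTimes m ε K ρ t) (n : ℕ) : 0 ≤ t n := by
  cases n with
  | zero => exact h.zero.ge
  | succ n => exact le_trans (by positivity) (h.succ_le n)

theorem one_le (h : IsFastTimes m ε K ρ t) (n : ℕ) : 1 ≤ t (n + 1) :=
  le_trans (by simp) (h.succ_le n)

theorem strictMono (h : IsFastTimes m ε K ρ t) : StrictMono t :=
  strictMono_nat_of_lt_succ fun n => by
    have h1 := h.two_mul_le n
    have h2 := h.nonneg n
    have h3 := h.one_le n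
    linarith

theorem tendsto (h : IsFastTimes m ε K ρ t) : Tendsto t atTop atTop := by
  refine (tendsto_add_atTop_iff_nat 1).1
    (tendsto_atTop_mono (fun n => ?_) tendsto_natCast_atTop_atTop)
  have := h.succ_le n
  linarith

/-- Doubling lets each time dominate the sum of all earlier ones; thus a product of exponentials in
the `t_i` is controlled by one in `t_{n+1}`. -/
theorem sum_le (h : IsFastTimes m ε K ρ t) (n : ℕ) :
    ∑ i ∈ Finset.range (n + 1), t i ≤ t (n + 1) := by
  induction n with
  | zero => simpa [h.zero] using h.nonneg 1
  | succ n ih =>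
    rw [Finset.sum_range_succ]
    have := h.two_mul_le (n + 1)
    linarith

end IsFastTimes

/-! ### Diophantine vectors belong to the class -/

section Diophantine

variable {m : ℕ} {F : Set (G m)} {α : Fin m → ℝ} {t σ : ℕ → ℝ} {θ ε L K ρ : ℝ}

theorem cfGamma_ne_zero (hB : ∀ n, FlowBound α θ L K (cfP F α t n) (t n)) (n : ℕ) :
    cfGamma F α t n ≠ 0 := by
  refine mul_ne_zero (Real.exp_pos _).ne' fun h => ?_
  have := (hB n).le_last
  rw [h, abs_zero, mul_zero] at this
  linarith

theorem opNorm_mul_inv_le {P Q : Gam m} {q : ℝ} (hP : entryNorm (toMat P⁻¹) ≤ q)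
    (hQ : entryNorm (toMat Q) ≤ q) : opNorm (toMat (Q * P⁻¹)) ≤ q ^ 2 := by
  have e : toMat (Q * P⁻¹) = toMat Q * toMat P⁻¹ := by
    rw [toMat, toG_mul, Matrix.SpecialLinearGroup.coe_mul]; rfl
  rw [e, sq]
  exact (opNorm_le_entryNorm _).trans ((entryNorm_mul_le _ _).trans
    (mul_le_mul hQ hP (entryNorm_nonneg _) ((entryNorm_nonneg _).trans hQ)))

/-- Equality would give `e^{m(T - t_n)} ≤ K² e^{θ t_n + mθT}` with `T = t_{n+1}`. As `θ < 1`, `m ≥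
1` and `(m + 1) t_n ≤ ε T`, the left exponent exceeds the right one by at least `ε T / 2`, which is
too much for `K²`. -/
theorem cfP_succ_ne (hm : 1 ≤ m) (hK : 1 ≤ K) (hθ1 : θ + 2 * ε = 1) (hε : 0 < ε)
    (ht : IsFastTimes m ε K ρ t) (hB : ∀ n, FlowBound α θ L K (cfP F α t n) (t n)) (n : ℕ) :
    cfP F α t (n + 1) ≠ cfP F α t n := by
  intro h
  have h1 := (exp_le_of_cfP_eq h).trans (mul_le_mul (hB n).flow_inv (hB (n + 1)).flow
    (entryNorm_nonneg _) (by positivity))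
  set T := t (n + 1) with hT
  have hT1 : 1 ≤ T := ht.one_le n
  have h0 := ht.nonneg n
  have h2 := ht.mul_le n
  have hm' : (1 : ℝ) ≤ m := by exact_mod_cast hm
  have h3 : θ * t n + m * θ * T + ε / 2 * T ≤ m * (T - t n) := by
    have e : θ = 1 - 2 * ε := by linarith
    have h4 : 0 ≤ (m - 1) * (ε * T) := mul_nonneg (by linarith) (by positivity)
    have h5 : 0 ≤ ε * T := by positivity
    have h6 : 0 ≤ ε * t n := by positivity
    rw [e]
    nlinarith
  have h7 : Real.exp (θ * t n) * Real.exp (m * θ * T) * (2 * K ^ 2) ≤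
      Real.exp (θ * t n) * Real.exp (m * θ * T) * K ^ 2 := by
    calc _ ≤ Real.exp (θ * t n) * Real.exp (m * θ * T) * Real.exp (ε / 2 * T) := by
          gcongr; exact ht.le_exp n
      _ = Real.exp (θ * t n + m * θ * T + ε / 2 * T) := by rw [Real.exp_add, Real.exp_add]
      _ ≤ _ := Real.exp_le_exp.2 h3
      _ ≤ _ := h1
      _ = _ := by ring
  have h8 := le_of_mul_le_mul_left h7 (by positivity)
  nlinarith

/-- With `s ≥ m + 1` the resonant coordinate is no larger than the contracted ones. For `T =
t_{n+1}` the total exponent is `θT + mθ t_n - (T - t_n) ≤ -2εT + (m + 1) t_n ≤ -εT`; half of this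
pays for the factor `2 K²`. -/
theorem resA_le_exp (hK : 1 ≤ K) (hθ1 : θ + 2 * ε = 1) (hε : 0 < ε)
    (ht : IsFastTimes m ε K ρ t) (hB : ∀ n, FlowBound α θ L K (cfP F α t n) (t n))
    {s : ℝ} (hs : (m : ℝ) + 1 ≤ s) (n : ℕ) :
    resA F α t (fun n => Real.exp (-(s * t (n + 1)))) n ≤ Real.exp (-(ε / 2 * t (n + 1))) := by
  refine (resA_le (Real.exp_pos _).le (cfGamma_ne_zero hB n)).trans ?_
  set T := t (n + 1) with hT
  have hT1 : 1 ≤ T := ht.one_le n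
  have h0 := ht.nonneg n
  have h2 := ht.mul_le n
  have hm0 : (0 : ℝ) ≤ m := by positivity
  have h3 : Real.exp (m * (T - t n)) * Real.exp (-(s * T)) ≤ Real.exp (-(T - t n)) := by
    rw [← Real.exp_add]
    refine Real.exp_le_exp.2 ?_
    have h4 : 0 ≤ (s - (m + 1)) * T := mul_nonneg (by linarith) (by linarith)
    have h5 : 0 ≤ ((m : ℝ) + 1) * t n := by positivity
    linarith
  calc _ ≤ (K * Real.exp (θ * T)) * ((K * Real.exp (m * θ * t n)) *
        (Real.exp (-(T - t n)) + Real.exp (-(T - t n)))) := by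
        have hW := entryNorm_nonneg (flowW (cfP F α t n) α (t n)).1
        exact mul_le_mul (hB (n + 1)).flow_inv (mul_le_mul (hB n).flow
          (add_le_add le_rfl h3) (by positivity) (by positivity)) (by positivity) (by positivity)
    _ = 2 * K ^ 2 * Real.exp (θ * T + m * θ * t n + -(T - t n)) := by
        rw [Real.exp_add, Real.exp_add]; ring
    _ ≤ Real.exp (ε / 2 * T) * Real.exp (-(ε * T)) := by
        refine mul_le_mul (ht.le_exp n) (Real.exp_le_exp.2 ?_) (Real.exp_pos _).le
          (Real.exp_pos _).le
        have h6 : m * θ * t n ≤ m * t n := by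
          have : 0 ≤ m * t n := by positivity
          nlinarith
        have e : θ = 1 - 2 * ε := by linarith
        rw [e] at h6 ⊢
        nlinarith
    _ = _ := by rw [← Real.exp_add]; congr 1; ring

/-- All factors are at most one, and the last one alone gives enough decay. -/
theorem prod_resA_le (hK : 1 ≤ K) (hθ1 : θ + 2 * ε = 1) (hε : 0 < ε)
    (ht : IsFastTimes m ε K ρ t) (hB : ∀ n, FlowBound α θ L K (cfP F α t n) (t n))
    {s : ℝ} (hs : (m : ℝ) + 1 ≤ s) (n : ℕ) :
    ∏ i ∈ Finset.range (n + 1), resA F α t (fun n => Real.exp (-(s * t (n + 1)))) i ≤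
      Real.exp (-(ε / 2 * t (n + 1))) := by
  have h := resA_le_exp hK hθ1 hε ht hB hs
  rw [Finset.prod_range_succ]
  refine (mul_le_of_le_one_left (resA_nonneg _ _) ?_).trans (h n)
  refine Finset.prod_le_one (fun i _ => resA_nonneg _ _) fun i _ => (h i).trans ?_
  rw [Real.exp_le_one_iff, neg_nonpos]
  have := ht.nonneg (i + 1)
  positivity

/-- `λ_i` is the inverse of the last component of `P_i ω`, so both `FlowBound` estimates on `P_i ω`
place `|λ_i|` between `q⁻¹` and `q`. The ratio of widths is `exp (s (t_{n+2} - t_{n+1}))`, at most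
`exp (s ρ t_{n+1})`. -/
theorem abs_log_term_le (hK : 1 ≤ K) (hL : 0 ≤ L) (hρ : 0 ≤ ρ)
    (ht : IsFastTimes m ε K ρ t) (hB : ∀ n, FlowBound α θ L K (cfP F α t n) (t n))
    {s : ℝ} (hs : 0 ≤ s) (n : ℕ) :
    |Real.log (|cfEta F α t (n + 1)| * opNorm (toMat (cfT F α t (n + 1))) *
        (Real.exp (-(s * t (n + 1))) * l1Norm (cfOmega F α t (n + 1)) /
          Real.exp (-(s * t (n + 1 + 1)))))| ≤
      (6 * Real.log K + 6 * L + s * ρ) * t (n + 1) := by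
  set T := t (n + 1) with hT
  have hT1 : 1 ≤ T := ht.one_le n
  have hmono : t n ≤ T := (ht.strictMono (Nat.lt_succ_self n)).le
  have hmono' : T ≤ t (n + 2) := (ht.strictMono (Nat.lt_succ_self (n + 1))).le
  set q := K * Real.exp (L * T) with hq
  have hexp1 : 1 ≤ Real.exp (L * T) := Real.one_le_exp (by positivity)
  have hq1 : 1 ≤ q := by nlinarith
  have hle : K * Real.exp (L * t n) ≤ q := by
    refine mul_le_mul_of_nonneg_left (Real.exp_le_exp.2 ?_) (by linarith)
    exact mul_le_mul_of_nonneg_left hmono hL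
  have hlam : ∀ i, K * Real.exp (L * t i) ≤ q →
      1 ≤ q * |cfLambda F α t i| ∧ |cfLambda F α t i| ≤ q := fun i hi => by
    have h1 := (hB i).le_last
    have h2 := (abs_apply_le_l1Norm _ (Fin.last m)).trans (hB i).vec_le
    rw [cfLambda_eq, abs_inv]
    set x := |(toMat (cfP F α t i)).mulVec (vec α) (Fin.last m)|
    have hx : 0 < x := pos_of_mul_pos_right (zero_lt_one.trans_le h1) (by positivity)
    refine ⟨?_, ?_⟩
    · rw [← div_eq_mul_inv, le_div_iff₀ hx, one_mul]
      exact h2.trans hi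
    · rw [inv_eq_one_div, div_le_iff₀ hx]
      exact h1.trans (mul_le_mul_of_nonneg_right hi hx.le)
  obtain ⟨ha1, ha2⟩ := hlam (n + 1) le_rfl
  obtain ⟨hb1, hb2⟩ := hlam n hle
  have hγ := cfGamma_ne_zero hB (n + 1)
  have heta : |cfEta F α t (n + 1)| =
      |cfLambda F α t (n + 1)| * |cfLambda F α t n|⁻¹ := by
    rw [cfEta, abs_div, div_eq_mul_inv]; simp
  set lb := |cfLambda F α t n| with hlb
  have hlb0 : 0 < lb := pos_of_mul_pos_right (zero_lt_one.trans_le hb1) (by positivity)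
  have hω : l1Norm (cfOmega F α t (n + 1)) ≤ q ^ 2 := by
    rw [cfOmega, l1Norm_smul, sq]
    exact mul_le_mul ha2 (hB (n + 1)).vec_le (l1Norm_nonneg _) (by positivity)
  -- The last coordinate of `ω_{n+1}` is `1` by normalization.
  have hω1 : 1 ≤ l1Norm (cfOmega F α t (n + 1)) := by
    have := abs_apply_le_l1Norm (cfOmega F α t (n + 1)) (Fin.last m)
    rwa [cfOmega_last _ _ _ hγ, abs_one] at this
  set la := |cfLambda F α t (n + 1)| with hla
  have hla0 : 0 ≤ la := abs_nonneg _
  have heta1 : la * lb⁻¹ ≤ q ^ 2 := by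
    rw [sq]
    refine mul_le_mul ha2 ?_ (by positivity) (by positivity)
    rw [inv_eq_one_div, div_le_iff₀ hlb0]; exact hb1
  have heta2 : 1 ≤ la * lb⁻¹ * q ^ 2 := by
    have h1 : 1 ≤ q * lb⁻¹ := by
      rw [← div_eq_mul_inv, le_div_iff₀ hlb0, one_mul]; exact hb2
    calc 1 ≤ (q * la) * (q * lb⁻¹) := one_le_mul_of_one_le_of_one_le ha1 h1
      _ = _ := by ring
  have hT2 : opNorm (toMat (cfT F α t (n + 1))) ≤ q ^ 2 :=
    opNorm_mul_inv_le ((hB n).mat_inv.trans hle) (hB (n + 1)).mat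
  have hT3 : 1 ≤ opNorm (toMat (cfT F α t (n + 1))) := one_le_opNorm_toMat _
  set w := l1Norm (cfOmega F α t (n + 1))
  set o := opNorm (toMat (cfT F α t (n + 1)))
  have hσ : Real.exp (-(s * T)) * w / Real.exp (-(s * t (n + 1 + 1))) =
      w * Real.exp (s * (t (n + 2) - T)) := by
    rw [mul_sub, sub_eq_add_neg, Real.exp_add, Real.exp_neg (s * t (n + 1 + 1)), div_inv_eq_mul]
    ring
  have hE1 : 1 ≤ Real.exp (s * (t (n + 2) - T)) :=
    Real.one_le_exp (mul_nonneg hs (by linarith))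
  have hE2 : Real.exp (s * (t (n + 2) - T)) ≤ Real.exp (s * (ρ * T)) := by
    refine Real.exp_le_exp.2 (mul_le_mul_of_nonneg_left ?_ hs)
    have := ht.le_mul n
    linarith
  rw [heta, hσ]
  set e := Real.exp (s * (t (n + 2) - T))
  refine (abs_log_le (e := s * (ρ * T)) hq1 (by positivity) ?_ ?_).trans ?_
  · calc 1 ≤ (la * lb⁻¹ * q ^ 2) * (o * (w * e)) :=
        one_le_mul_of_one_le_of_one_le heta2 (one_le_mul_of_one_le_of_one_le hT3
          (one_le_mul_of_one_le_of_one_le hω1 hE1))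
      _ = _ := by ring
  · calc la * lb⁻¹ * o * (w * e) ≤ q ^ 2 * q ^ 2 * (q ^ 2 * Real.exp (s * (ρ * T))) := by
          gcongr
      _ = _ := by ring
  · rw [hq, Real.log_mul (by positivity) (Real.exp_pos _).ne', Real.log_exp]
    have := Real.log_nonneg hK
    nlinarith

theorem summable_resA_mul_log (hK : 1 ≤ K) (hθ1 : θ + 2 * ε = 1) (hε : 0 < ε)
    (hL : 0 ≤ L) (hρ : 0 ≤ ρ)
    (ht : IsFastTimes m ε K ρ t) (hB : ∀ n, FlowBound α θ L K (cfP F α t n) (t n))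
    {s : ℝ} (hs : (m : ℝ) + 1 ≤ s) :
    Summable (fun n : ℕ =>
      (∏ i ∈ Finset.range (n + 1), resA F α t (fun n => Real.exp (-(s * t (n + 1)))) i) *
      Real.log (|cfEta F α t (n + 1)| * opNorm (toMat (cfT F α t (n + 1))) *
        (Real.exp (-(s * t (n + 1))) * l1Norm (cfOmega F α t (n + 1)) /
          Real.exp (-(s * t (n + 1 + 1)))))) := by
  have hs0 : 0 ≤ s := le_trans (by positivity) hs
  set D := 6 * Real.log K + 6 * L + s * ρ with hD
  have hD0 : 0 ≤ D := by
    have := Real.log_nonneg hK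
    positivity
  refine Summable.of_norm_bounded (ht.summable.mul_left (D * (2 / (ε / 2) ^ 2))) fun n => ?_
  have hT : 0 < t (n + 1) := zero_lt_one.trans_le (ht.one_le n)
  rw [norm_mul, Real.norm_eq_abs, Real.norm_eq_abs,
    abs_of_nonneg (Finset.prod_nonneg fun i _ => resA_nonneg _ _)]
  calc _ ≤ Real.exp (-(ε / 2 * t (n + 1))) * (D * t (n + 1)) :=
        mul_le_mul (prod_resA_le hK hθ1 hε ht hB hs n)
          (abs_log_term_le hK hL hρ ht hB hs0 n) (abs_nonneg _) (Real.exp_pos _).le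
    _ = D * (Real.exp (-(ε / 2 * t (n + 1))) * t (n + 1)) := by ring
    _ ≤ D * (2 / (ε / 2) ^ 2 * (t (n + 1))⁻¹) :=
        mul_le_mul_of_nonneg_left (exp_neg_mul_mul_le (by positivity) hT) hD0
    _ = _ := by ring

/-- Each factor is at most `(K e^{L t_i})^4`. The exponents `L t_i` add up to at most `L t_{n+1}`,
and the `n + 1` constants `4 log K` are absorbed by `n + 1 ≤ t_{n+1}`. -/
theorem prod_opNorm_cfT_sq_le (hK : 1 ≤ K) (hL : 0 ≤ L)
    (ht : IsFastTimes m ε K ρ t) (hB : ∀ n, FlowBound α θ L K (cfP F α t n) (t n)) (n : ℕ) :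
    ∏ i ∈ Finset.range (n + 1), opNorm (toMat (cfT F α t i)) ^ 2 ≤
      Real.exp ((4 * Real.log K + 4 * L) * t (n + 1)) := by
  have hT : ∀ i, opNorm (toMat (cfT F α t i)) ^ 2 ≤
      Real.exp (4 * Real.log K + 4 * (L * t i)) := by
    intro i
    have h1 : opNorm (toMat (cfT F α t i)) ≤ (K * Real.exp (L * t i)) ^ 2 := by
      cases i with
      -- `T_0 = I` is written `P_0 P_0⁻¹` so that the estimate of the other transfer matrices
      -- applies.
      | zero => rw [cfT_zero_eq]; exact opNorm_mul_inv_le (hB 0).mat_inv (hB 0).mat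
      | succ i =>
        refine opNorm_mul_inv_le ((hB i).mat_inv.trans ?_) (hB (i + 1)).mat
        have := (ht.strictMono (Nat.lt_succ_self i)).le
        exact mul_le_mul_of_nonneg_left (Real.exp_le_exp.2
          (mul_le_mul_of_nonneg_left this hL)) (by linarith)
    refine (pow_le_pow_left₀ (opNorm_nonneg _) h1 2).trans_eq ?_
    have hK0 : K = Real.exp (Real.log K) := (Real.exp_log (by linarith)).symm
    conv_lhs => rw [hK0]
    rw [← Real.exp_add, ← pow_mul, ← Real.exp_nat_mul]
    congr 1
    push_cast
    ring
  refine (Finset.prod_le_prod (fun i _ => sq_nonneg _) fun i _ => hT i).trans ?_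
  rw [← Real.exp_sum, Finset.sum_add_distrib, ← Finset.mul_sum, ← Finset.mul_sum,
    ← Finset.mul_sum]
  refine Real.exp_le_exp.2 ?_
  rw [Finset.sum_const, Finset.card_range, nsmul_eq_mul, Nat.cast_add, Nat.cast_one]
  have h1 := mul_le_mul_of_nonneg_left (ht.sum_le n) hL
  have h2 := mul_le_mul_of_nonneg_left (ht.succ_le n) (Real.log_nonneg hK)
  linarith

theorem opNorm_cfP_inv_le (hK : 1 ≤ K) (hL : 0 ≤ L)
    (ht : IsFastTimes m ε K ρ t) (hB : ∀ n, FlowBound α θ L K (cfP F α t n) (t n)) (n : ℕ) :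
    opNorm (toMat (cfP F α t n)⁻¹) ≤ Real.exp ((Real.log K + L) * t (n + 1)) := by
  refine (opNorm_le_entryNorm _).trans ((hB n).mat_inv.trans ?_)
  have hK0 : K = Real.exp (Real.log K) := (Real.exp_log (by linarith)).symm
  conv_lhs => rw [hK0]
  rw [← Real.exp_add, add_mul]
  refine Real.exp_le_exp.2 (add_le_add (le_mul_of_one_le_right (Real.log_nonneg hK)
    (ht.one_le n)) (mul_le_mul_of_nonneg_left ?_ hL))
  exact (ht.strictMono (Nat.lt_succ_self n)).le

theorem IsFastTimes.two_pow_le (ht : IsFastTimes m ε K ρ t) (n : ℕ) :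
    (2 : ℝ) ^ (2 * n) ≤ Real.exp (2 * t (n + 1)) := by
  have h2 : (2 : ℝ) ≤ Real.exp 1 := by
    have := Real.add_one_le_exp (1 : ℝ)
    linarith
  refine (pow_le_pow_left₀ zero_le_two h2 (2 * n)).trans ?_
  rw [← Real.exp_nat_mul]
  refine Real.exp_le_exp.2 ?_
  have := ht.succ_le n
  push_cast
  linarith

/-- The threshold for `s` adds the rates to be beaten: `2` for `2^{2n}`, `log K + L` for `P_n⁻¹`,
four times this for the product, and `1` left over so that `e^{-t_{n+1}}` remains. -/
theorem tendsto_resWidths_mul (hK : 1 ≤ K) (hL : 0 ≤ L)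
    (ht : IsFastTimes m ε K ρ t) (hB : ∀ n, FlowBound α θ L K (cfP F α t n) (t n))
    {s : ℝ} (hs : 3 + 5 * Real.log K + 5 * L ≤ s) :
    Tendsto (fun n : ℕ => 2 ^ (2 * n) * Real.exp (-(s * t (n + 1))) *
      opNorm (toMat (cfP F α t n)⁻¹) *
      ∏ i ∈ Finset.range (n + 1), opNorm (toMat (cfT F α t i)) ^ 2) atTop (𝓝 0) := by
  have hlim : Tendsto (fun n => Real.exp (-(t (n + 1)))) atTop (𝓝 0) :=
    Real.tendsto_exp_neg_atTop_nhds_zero.comp ((tendsto_add_atTop_iff_nat 1).2 ht.tendsto)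
  have hprod : ∀ n, 0 ≤ ∏ i ∈ Finset.range (n + 1), opNorm (toMat (cfT F α t i)) ^ 2 :=
    fun n => Finset.prod_nonneg fun i _ => sq_nonneg _
  have h4 : ∀ n, (0 : ℝ) ≤ 2 ^ (2 * n) := fun n => pow_nonneg zero_le_two _
  refine squeeze_zero (fun n => mul_nonneg (mul_nonneg (mul_nonneg (h4 n)
    (Real.exp_pos _).le) (opNorm_nonneg _)) (hprod n)) (fun n => ?_) hlim
  refine (mul_le_mul (mul_le_mul (mul_le_mul_of_nonneg_right (ht.two_pow_le n)
    (Real.exp_pos _).le) (opNorm_cfP_inv_le hK hL ht hB n) (opNorm_nonneg _)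
    (mul_nonneg (Real.exp_pos _).le (Real.exp_pos _).le)) (prod_opNorm_cfT_sq_le hK hL ht hB n)
    (hprod n) (mul_nonneg (mul_nonneg (Real.exp_pos _).le (Real.exp_pos _).le)
    (Real.exp_pos _).le)).trans ?_
  rw [← Real.exp_add, ← Real.exp_add, ← Real.exp_add]
  refine Real.exp_le_exp.2 ?_
  have h5 := mul_le_mul_of_nonneg_right hs (ht.nonneg (n + 1))
  linarith

theorem isYVec_of_diophantine (hm : 1 ≤ m) (hF : IsFundDomain F) {c C : ℝ}
    (hS : F ⊆ siegelSet m c C) (h : vec α ∈ diophantine m) : IsYVec F α := by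
  obtain ⟨θ, L, K, hθ1, hL, hK, hone, hflow⟩ := exists_flowBound h hS
  set ε := (1 - θ) / 2 with hε
  have hε0 : 0 < ε := by rw [hε]; linarith
  have hθε : θ + 2 * ε = 1 := by rw [hε]; ring
  obtain ⟨ρ, t, hρ, ht⟩ := exists_isFastTimes m hε0 hK
  have hB := flowBound_cfP hF hone hflow ht.zero ht.nonneg
  have hlog := Real.log_nonneg hK
  have hm0 : (0 : ℝ) ≤ m := by positivity
  -- The sum meets both demands on `s`: at least `m + 1` for the contraction, at least the other
  -- term for the limit. The width `σ_n` is tied to `t_{n+1}`, not `t_n`, because `A_n` involves the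
  -- flow up to time `t_{n+1}`.
  set s : ℝ := m + 1 + (3 + 5 * Real.log K + 5 * L) with hs
  refine ⟨fun n => Real.exp (-(s * t (n + 1))), t, ⟨fun n => Real.exp_pos _, fun i j hij => ?_⟩,
    ⟨ht.zero, ht.strictMono, ht.tendsto, cfP_succ_ne hm hK hθε hε0 ht hB⟩,
    cfGamma_ne_zero hB, summable_resA_mul_log hK hθε hε0 hL hρ ht hB (by linarith),
    tendsto_resWidths_mul hK hL ht hB (by linarith)⟩
  refine Real.exp_lt_exp.2 (neg_lt_neg (mul_lt_mul_of_pos_left ?_ (by linarith)))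
  exact ht.strictMono (Nat.succ_lt_succ hij)

theorem vec_div_last {ω : Fin (m + 1) → ℝ} (h : ω (Fin.last m) ≠ 0) :
    vec (fun i : Fin m => ω i.castSucc / ω (Fin.last m)) = (ω (Fin.last m))⁻¹ • ω := by
  funext i
  refine Fin.lastCases ?_ (fun j => ?_) i
  · simp [h]
  · simp [div_eq_inv_mul]

theorem last_ne_zero_of_diophantine {ω : Fin (m + 1) → ℝ} (h : ω ∈ diophantine m) :
    ω (Fin.last m) ≠ 0 := by
  obtain ⟨β, -, C, hC, h⟩ := h
  intro h0
  -- Tested on the last basis vector, the diophantine condition bounds the last coordinate away from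
  -- zero.
  have h1 := h (Pi.single (Fin.last m) 1) (by simp)
  have e : intVec (Pi.single (Fin.last m) (1 : ℤ)) =
      (Pi.single (Fin.last m) (1 : ℝ) : Fin (m + 1) → ℝ) := by
    funext i
    by_cases hi : i = Fin.last m
    · subst hi; simp [intVec]
    · simp [intVec, hi]
  have h2 : 0 ≤ C / l1Norm (intVec (Pi.single (Fin.last m) (1 : ℤ))) ^ ((m : ℝ) + β) :=
    div_nonneg hC.le (Real.rpow_nonneg (l1Norm_nonneg _) _)
  rw [e, dotProduct_single, h0, zero_mul, abs_zero, ← e] at h1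
  linarith

theorem smul_mem_diophantine {ω : Fin (m + 1) → ℝ} (h : ω ∈ diophantine m) {r : ℝ}
    (hr : r ≠ 0) : r • ω ∈ diophantine m := by
  obtain ⟨β, hβ, C, hC, h⟩ := h
  have hr0 : 0 < |r| := abs_pos.2 hr
  refine ⟨β, hβ, |r| * C, by positivity, fun k hk => ?_⟩
  rw [smul_dotProduct, smul_eq_mul, abs_mul, mul_div_assoc]
  exact mul_lt_mul_of_pos_left (h k hk) hr0

theorem diophantine_subset_classY (hm : 1 ≤ m) (hF : IsFundDomain F) {c C : ℝ}
    (hS : F ⊆ siegelSet m c C) : diophantine m ⊆ classY F := by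
  intro ω h
  have h0 := last_ne_zero_of_diophantine h
  refine ⟨h0, isYVec_of_diophantine hm hF hS ?_⟩
  rw [vec_div_last h0]
  exact smul_mem_diophantine h (inv_ne_zero h0)

end Diophantine

/-! ### Almost every vector is diophantine -/

section FullMeasure

variable {ι : Type*} [Fintype ι]

/-- The volume of a slice of a cube between two close parallel hyperplanes with an integer normal
vector. -/
theorem volume_slice_le {a : ι → ℤ} (ha : a ≠ 0) (b : ℝ) {δ R : ℝ} (hδ : 0 ≤ δ) (hR : 1 ≤ R) :
    volume {x : ι → ℝ | (∀ i, |x i| ≤ R) ∧ |dotProduct (intVec a) x + b| ≤ δ} ≤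
      ENNReal.ofReal ((2 * R) ^ Fintype.card ι * (2 * δ)) := by
  classical
  obtain ⟨i, hi⟩ := Function.ne_iff.mp ha
  have hi1 : 1 ≤ |(a i : ℝ)| := by exact_mod_cast Int.one_le_abs hi
  -- Replacing the coordinate `x i` by the form `a·x` has determinant `a i`, of absolute value at
  -- least one, and sends the slice into a box.
  set A : Matrix ι ι ℝ := (1 : Matrix ι ι ℝ).updateRow i (intVec a) with hA
  have hdet : LinearMap.det (Matrix.toLin' A) = a i := by
    rw [LinearMap.det_toLin', hA, ← Matrix.transpose_one, ← Matrix.cramer_transpose_apply]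
    simp [intVec]
  have hdet0 : LinearMap.det (Matrix.toLin' A) ≠ 0 := by
    rw [hdet]; intro h; rw [h, abs_zero] at hi1; linarith
  set box : Set (ι → ℝ) := Set.pi Set.univ fun j =>
    if j = i then Set.Icc (-b - δ) (-b + δ) else Set.Icc (-R) R with hbox
  have hsub : {x : ι → ℝ | (∀ i, |x i| ≤ R) ∧ |dotProduct (intVec a) x + b| ≤ δ} ⊆
      Matrix.toLin' A ⁻¹' box := by
    rintro x ⟨h1, h2⟩
    rw [Set.mem_preimage, hbox, Set.mem_univ_pi]
    intro j
    rw [Matrix.toLin'_apply, Matrix.mulVec, hA]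
    by_cases hj : j = i
    · subst hj
      rw [if_pos rfl, Matrix.updateRow_self]
      rw [abs_le] at h2
      exact ⟨by linarith [h2.1], by linarith [h2.2]⟩
    · rw [if_neg hj, Matrix.updateRow_ne hj]
      have : dotProduct ((1 : Matrix ι ι ℝ) j) x = x j := by
        have := congrFun (Matrix.one_mulVec x) j
        exact this
      rw [this]
      exact abs_le.1 (h1 j)
  refine (measure_mono hsub).trans ?_
  rw [Measure.addHaar_preimage_linearMap _ hdet0, hdet, hbox, volume_pi_pi]
  calc _ ≤ 1 * ∏ j, ENNReal.ofReal (if j = i then 2 * δ else 2 * R) := by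
        refine mul_le_mul' ?_ (le_of_eq (Finset.prod_congr rfl fun j _ => ?_))
        · rw [ENNReal.ofReal_le_one, abs_inv]
          exact inv_le_one_of_one_le₀ hi1
        · split_ifs
          · rw [Real.volume_Icc]; congr 1; ring
          · rw [Real.volume_Icc]; congr 1; ring
    _ = ENNReal.ofReal (∏ j, if j = i then 2 * δ else 2 * R) := by
        rw [one_mul, ENNReal.ofReal_prod_of_nonneg]
        intro j _
        split_ifs <;> linarith
    _ ≤ _ := by
        refine ENNReal.ofReal_le_ofReal ?_
        rw [← Finset.mul_prod_erase _ _ (Finset.mem_univ i), if_pos rfl, mul_comm]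
        refine mul_le_mul_of_nonneg_right ?_ (by linarith)
        calc _ = ∏ j ∈ Finset.univ.erase i, (2 * R) :=
              Finset.prod_congr rfl fun j hj => if_neg (Finset.ne_of_mem_erase hj)
          _ ≤ (2 * R) ^ Fintype.card ι := by
              rw [Finset.prod_const]
              exact pow_le_pow_right₀ (by linarith) (Finset.card_le_univ _)

/-- Almost every point is far, relatively to a summable weight, from the zeros of affine forms with
integer linear parts. -/
theorem ae_exists_mul_lt_abs {κ : Type*} [Countable κ] {a : κ → ι → ℤ} (ha : ∀ k, a k ≠ 0)
    (b : κ → ℝ) {w : κ → ℝ} (hw0 : ∀ k, 0 ≤ w k) (hw : Summable w) :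
    ∀ᵐ x : ι → ℝ, ∃ C : ℝ, 0 < C ∧ ∀ k, C * w k < |dotProduct (intVec (a k)) x + b k| := by
  have hbox : ∀ N : ℕ, ∀ᵐ x : ι → ℝ, (∀ i, |x i| ≤ (N : ℝ) + 1) →
      ∃ C : ℝ, 0 < C ∧ ∀ k, C * w k < |dotProduct (intVec (a k)) x + b k| := by
    intro N
    set R : ℝ := (N : ℝ) + 1 with hR
    have hR1 : 1 ≤ R := by simp [hR]
    set M : ℝ := (2 * R) ^ Fintype.card ι * 2 * ∑' k, w k with hM
    -- A bad point violates the inequality for every `C`, hence lies for each `C` in a union of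
    -- slices of total volume at most `M * C`; letting `C` tend to `0` shows that the bad set is
    -- null.
    have hbound : ∀ C : ℝ, 0 < C →
        volume {x : ι → ℝ | ¬ ((∀ i, |x i| ≤ R) →
          ∃ C : ℝ, 0 < C ∧ ∀ k, C * w k < |dotProduct (intVec (a k)) x + b k|)} ≤
        ENNReal.ofReal (M * C) := by
      intro C hC
      calc _ ≤ volume (⋃ k, {x : ι → ℝ | (∀ i, |x i| ≤ R) ∧
            |dotProduct (intVec (a k)) x + b k| ≤ C * w k}) := by
            refine measure_mono fun x hx => ?_
            simp only [Set.mem_ofPred_eq, Classical.not_imp, not_exists, not_and, not_forall, not_lt] at hx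
            obtain ⟨k, hk⟩ := hx.2 C hC
            exact Set.mem_iUnion.2 ⟨k, hx.1, hk⟩
        _ ≤ ∑' k, ENNReal.ofReal ((2 * R) ^ Fintype.card ι * (2 * (C * w k))) :=
            (measure_iUnion_le _).trans (ENNReal.tsum_le_tsum fun k =>
              volume_slice_le (ha k) _ (mul_nonneg hC.le (hw0 k)) hR1)
        _ = ∑' k, ENNReal.ofReal (((2 * R) ^ Fintype.card ι * 2 * C) * w k) := by
            congr 1; funext k; congr 1; ring
        _ = ENNReal.ofReal (∑' k, ((2 * R) ^ Fintype.card ι * 2 * C) * w k) :=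
            (ENNReal.ofReal_tsum_of_nonneg (fun k => mul_nonneg (by positivity) (hw0 k))
              (hw.mul_left _)).symm
        _ = _ := by rw [tsum_mul_left, hM]; congr 1; ring
    rw [ae_iff]
    have hlim : Tendsto (fun C : ℝ => ENNReal.ofReal (M * C)) (𝓝[>] 0) (𝓝 0) := by
      have : Tendsto (fun C : ℝ => ENNReal.ofReal (M * C)) (𝓝 0) (𝓝 (ENNReal.ofReal (M * 0))) :=
        (ENNReal.continuous_ofReal.comp (continuous_const.mul continuous_id)).tendsto 0
      rw [mul_zero, ENNReal.ofReal_zero] at this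
      exact this.mono_left nhdsWithin_le_nhds
    refine le_antisymm (ge_of_tendsto hlim ?_) zero_le
    filter_upwards [self_mem_nhdsWithin] with C hC using hbound C hC
  filter_upwards [ae_all_iff.2 hbox] with x hx
  obtain ⟨N, hN⟩ := exists_nat_ge (l1Norm x)
  refine hx N fun i => ?_
  have := abs_apply_le_l1Norm x i
  linarith

/-- Comparison with the sum of sup norms over the lattice of integer vectors, whose rank is the
dimension. The term `k = 0` vanishes by the convention for the inverse of zero. -/
theorem summable_inv_l1Norm_intVec_rpow {s : ℝ} (hs : (Fintype.card ι : ℝ) < s) :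
    Summable fun k : ι → ℤ => (l1Norm (intVec k) ^ s)⁻¹ := by
  classical
  set Λ := Submodule.span ℤ (Set.range (Pi.basisFun ℝ ι)) with hΛ
  have hmem : ∀ k : ι → ℤ, intVec k ∈ Λ := fun k => by
    rw [hΛ, Module.Basis.mem_span_iff_repr_mem]
    intro i
    exact ⟨k i, by simp [intVec]⟩
  have hrank : Module.finrank ℤ Λ = Fintype.card ι := by
    rw [ZLattice.rank ℝ, Module.finrank_fintype_fun_eq_card]
  have h := ZLattice.summable_norm_rpow Λ (-s) (by rw [hrank]; linarith)
  have hinj : Function.Injective fun k : ι → ℤ => (⟨intVec k, hmem k⟩ : Λ) := fun k l hkl => by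
    funext i
    have := congrFun (congrArg Subtype.val hkl) i
    simpa [intVec] using this
  have hcard : (0 : ℝ) ≤ Fintype.card ι := by positivity
  refine Summable.of_nonneg_of_le
    (fun k => inv_nonneg.2 (Real.rpow_nonneg (l1Norm_nonneg _) _)) (fun k => ?_)
    (h.comp_injective hinj)
  have hle : ‖intVec k‖ ≤ l1Norm (intVec k) :=
    (pi_norm_le_iff_of_nonneg (l1Norm_nonneg _)).2 fun i => abs_apply_le_l1Norm _ i
  by_cases hk : k = 0
  · subst hk
    have h0 : l1Norm (intVec (0 : ι → ℤ)) = 0 := by simp [l1Norm, intVec]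
    rw [h0, Real.zero_rpow (by linarith), inv_zero]
    exact Real.rpow_nonneg (norm_nonneg _) _
  · have hpos : 0 < ‖intVec k‖ := norm_pos_iff.2 fun h0 => hk <| by
      funext i
      have := congrFun h0 i
      simpa [intVec] using this
    simp only [Function.comp_def, Submodule.coe_norm]
    rw [Real.rpow_neg (norm_nonneg _)]
    exact inv_anti₀ (by positivity) (Real.rpow_le_rpow hpos.le hle (by linarith))

theorem ae_mem_diophantine (m : ℕ) : ∀ᵐ ω : Fin (m + 1) → ℝ, ω ∈ diophantine m := by
  have hsum := (summable_inv_l1Norm_intVec_rpow (ι := Fin (m + 1)) (s := (m : ℝ) + 2)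
    (by simp)).comp_injective (Subtype.val_injective (p := fun k => k ≠ 0))
  have h := ae_exists_mul_lt_abs (a := fun k : {k : Fin (m + 1) → ℤ // k ≠ 0} => k.1)
    (fun k => k.2) (fun _ => 0)
    (fun k => inv_nonneg.2 (Real.rpow_nonneg (l1Norm_nonneg (intVec k.1)) _)) hsum
  filter_upwards [h] with ω hω
  obtain ⟨C, hC, hω⟩ := hω
  -- Any `β > 1` would do: `m + β` must exceed the dimension `m + 1` for the weights to be summable.
  refine ⟨2, by norm_num, C, hC, fun k hk => ?_⟩
  have := hω ⟨k, hk⟩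
  rwa [add_zero, dotProduct_comm, ← div_eq_mul_inv] at this

/-- The vectors `(α, 1)` form a null set of the whole space, so the previous result does not apply
to them. Here `k·(α, 1)` is an affine form in `α`, with nonzero linear part unless only the last
coordinate of `k` is nonzero. -/
theorem ae_vec_mem_diophantine (m : ℕ) : ∀ᵐ α : Fin m → ℝ, vec α ∈ diophantine m := by
  have hsum := (summable_inv_l1Norm_intVec_rpow (ι := Fin (m + 1)) (s := (m : ℝ) + 2)
    (by simp)).comp_injective
    (Subtype.val_injective (p := fun k : Fin (m + 1) → ℤ => (fun i : Fin m => k i.castSucc) ≠ 0))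
  have h := ae_exists_mul_lt_abs
    (a := fun k : {k : Fin (m + 1) → ℤ // (fun i : Fin m => k i.castSucc) ≠ 0} =>
      fun i : Fin m => k.1 i.castSucc)
    (fun k => k.2) (fun k => (k.1 (Fin.last m) : ℝ))
    (fun k => inv_nonneg.2 (Real.rpow_nonneg (l1Norm_nonneg (intVec k.1)) _)) hsum
  filter_upwards [h] with α hα
  obtain ⟨C, hC, hα⟩ := hα
  -- The bound `1 / 2` serves the `k` with zero linear part, for which the form is a nonzero integer
  -- and its absolute value at least `1`.
  refine ⟨2, by norm_num, min C (1 / 2), by positivity, fun k hk => ?_⟩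
  have hl1 : 1 ≤ l1Norm (intVec k) := one_le_l1Norm_intVec hk
  have hpow : 1 ≤ l1Norm (intVec k) ^ ((m : ℝ) + 2) := Real.one_le_rpow hl1 (by positivity)
  have e : dotProduct (vec α) (intVec k) =
      dotProduct (intVec fun i : Fin m => k i.castSucc) α + k (Fin.last m) := by
    simp [dotProduct, Fin.sum_univ_castSucc, intVec, mul_comm]
  rw [e]
  by_cases hk' : (fun i : Fin m => k i.castSucc) = 0
  · have hlast : k (Fin.last m) ≠ 0 := fun h0 => hk <| by
      funext i
      exact Fin.lastCases h0 (fun j => congrFun hk' j) i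
    have h0 : intVec (0 : Fin m → ℤ) = 0 := by funext i; simp [intVec]
    have h1 : 1 ≤ |(k (Fin.last m) : ℝ)| := by exact_mod_cast Int.one_le_abs hlast
    rw [hk', h0, zero_dotProduct, zero_add]
    refine lt_of_lt_of_le ?_ h1
    rw [div_lt_one (by positivity)]
    have := min_le_right C (1 / 2 : ℝ)
    linarith
  · refine lt_of_le_of_lt ?_ (hα ⟨k, hk'⟩)
    rw [div_eq_mul_inv]
    exact mul_le_mul_of_nonneg_right (min_le_left _ _) (by positivity)

end FullMeasure

end TorusCF

theorem mainTheorem8 (m : ℕ) (hm : 1 ≤ m) (F : Set (TorusCF.G m))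
    (hF : TorusCF.IsFundDomain F) (c C : ℝ) (hS : F ⊆ TorusCF.siegelSet m c C) :
    TorusCF.diophantine m ⊆ TorusCF.classY F ∧
      (∀ᵐ ω : Fin (m + 1) → ℝ, ω ∈ TorusCF.classY F) ∧
      (∀ᵐ α : Fin m → ℝ, TorusCF.vec α ∈ TorusCF.classY F) := by
  have h := TorusCF.diophantine_subset_classY hm hF hS
  refine ⟨h, ?_, ?_⟩
  · filter_upwards [TorusCF.ae_mem_diophantine m] with ω hω using h hω
  · filter_upwards [TorusCF.ae_vec_mem_diophantine m] with α hα using h hα
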